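/- Let $A$ be a finite alphabet (discrete), $\sigma$ the left shift on $A^{\mathbb Z}$, $(\sigma x)_i=x_{i+1}$, and let $\mu$ be a Borel probability measure on $A^{\mathbb Z}$ such that $(A^{\mathbb Z},\sigma,\mu)$ is ergodic. Put $$d_1(x,y)=\limsup_{n\to\infty}\frac1{2n+1}\#\{|i|\le n: x_i\ne y_i\},\qquad D_1(x,y)=\inf_{n\in\mathbb Z}d_1(x,\sigma^n y).$$ Let $A^{\mathbb Z}_\sim$ be the quotient of $A^{\mathbb Z}$ by the relation $d_1(x,y)=0$, with quotient map $\tilde\pi$, metric $\tilde d_1(\tilde\pi x,\tilde\pi y)=d_1(x,y)$, induced shift $\tilde\sigma(\tilde\pi x)=\tilde\pi(\sigma x)$, and the $\sigma$-algebra generated by the open $\tilde d_1$-balls. Write $\mathcal O(u)=\{\tilde\sigma^n u:n\in\mathbb Z\}$ for $u\in A^{\mathbb Z}_\sim$; closures in $A^{\mathbb Z}_\sim$ are with respect to $\tilde d_1$. A point $x$ is generic for $\mu$ if $\frac1{2n+1}\sum_{|k|\le n}f(\sigma^kx)\to\int f\,d\mu$ for every continuous $f:A^{\mathbb Z}\to\mathbb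 C$. An eigenfunction of a measure-preserving system $(Y,T,m)$ with eigenvalue $\xi\in\mathbb C$ is a function $e\in L^2_m$, not $m$-a.e. zero, with $e\circ T=\xi e$ $m$-a.e.; it is normalized if $\|e\|_{L^2_m}=1$. a) There is a constant $\overline D_1(\mu)\in[0,1]$ such that $D_1(x,y)=\overline D_1(\mu)$ for $\mu\times\mu$-a.e. $(x,y)$. Suppose now that $\overline D_1(\mu)=0$. Then there is a $\sigma$-invariant measurable set $X_\mu\subseteq A^{\mathbb Z}$ such that, with $\tilde X_\mu:=\tilde\pi(X_\mu)$: b) $X_\mu$ is an equivalence class of the relation $D_1(x,y)=0$, $\mu(X_\mu)=1$, and every point of $X_\mu$ is generic for $\mu$. c) $\mathcal O(\tilde\pi x)$ is relatively compact in $(A^{\mathbb Z}_\sim,\tilde d_1)$ for every $x\in X_\mu$. d) $\tilde X_\mu=\overline{\mathcal O(\tilde x)}$ for every $\tilde x\in\tilde X_\mu$, and $X_\mu=\tilde\pi^{-1}(\tilde X_\mu)$. e) $\tilde X_\mu$ is $\tilde\sigma$-invariant and measurable, on $\tilde X_\mu$ the trace of the ball $\sigma$-algebra is the Borel $\sigma$-algebra,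 and $(\tilde X_\mu,\tilde d_1,\tilde\sigma)$ is a compact, minimal, invertible isometric system which is uniquely ergodic, its only invariant Borel probability measure being $\tilde\mu:=\mu\circ\tilde\pi^{-1}$. f) If $\tilde e_\xi$ is an eigenfunction of $(\tilde X_\mu,\tilde\sigma,\tilde\mu)$ with eigenvalue $\xi$, then $\tilde e_\xi$ has a continuous version (again denoted by $\tilde e_\xi$), and $e_\xi:=\tilde e_\xi\circ\tilde\pi$ is an everywhere defined eigenfunction of $(X_\mu,\sigma,\mu)$ with eigenvalue $\xi$, i.e. $e_\xi(\sigma x)=\xi\,e_\xi(x)$ for all $x\in X_\mu$; if $\tilde e_\xi$ is normalized, then $|e_\xi(x)|=1$ for all $x\in X_\mu$. -/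

import Mathlib

open MeasureTheory Filter Topology

namespace Besicovitch

/-- The number of indices `|i| ≤ n` with `x i ≠ y i`. -/
noncomputable def mismatches {A : Type*} (x y : ℤ → A) (n : ℕ) : ℕ :=
  open Classical in ((Finset.Icc (-(n : ℤ)) n).filter (fun i => x i ≠ y i)).card

/-- The Besicovitch pseudo-metric: the upper density of `{i | x i ≠ y i}`. -/
noncomputable def d1 {A : Type*} (x y : ℤ → A) : ℝ :=
  limsup (fun n : ℕ => (mismatches x y n : ℝ) / (2 * n + 1)) atTop

/-- The left shift `(σ x) i = x (i + 1)` on two-sided sequences. -/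
def shift (A : Type*) : Equiv.Perm (ℤ → A) where
  toFun x := fun i => x (i + 1)
  invFun x := fun i => x (i - 1)
  left_inv x := by funext i; simp
  right_inv x := by funext i; simp

/-- `D₁(x, y) = inf {d₁(x, σⁿ y) : n ∈ ℤ}`, a pseudo-metric on `A^ℤ`. -/
noncomputable def D1 {A : Type*} (x y : ℤ → A) : ℝ :=
  ⨅ n : ℤ, d1 x ((shift A ^ n) y)

/-- `X` is an equivalence class of the relation `D₁(x, y) = 0`. -/
def IsD1Class {A : Type*} (X : Set (ℤ → A)) : Prop :=
  ∃ x : ℤ → A, X = {y | D1 x y = 0}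

/-- `x` is generic for `μ`: all two-sided Birkhoff averages of continuous functions converge to
the integral. -/
def IsGeneric {A : Type*} [TopologicalSpace A] [MeasurableSpace A]
    (μ : Measure (ℤ → A)) (x : ℤ → A) : Prop :=
  ∀ f : C(ℤ → A, ℂ),
    Tendsto (fun n : ℕ => (1 / (2 * n + 1) : ℂ) *
      ∑ k ∈ Finset.Icc (-(n : ℤ)) n, f ((shift A ^ k) x)) atTop (𝓝 (∫ y, f y ∂μ))

section PseudoMetric

variable {A : Type*}

theorem mismatches_le (x y : ℤ → A) (n : ℕ) : mismatches x y n ≤ 2 * n + 1 := by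
  classical
  refine (Finset.card_filter_le _ _).trans ?_
  rw [Int.card_Icc]
  omega

theorem freq_nonneg (x y : ℤ → A) (n : ℕ) : (0 : ℝ) ≤ (mismatches x y n : ℝ) / (2 * n + 1) := by
  positivity

theorem freq_le_one (x y : ℤ → A) (n : ℕ) : (mismatches x y n : ℝ) / (2 * n + 1) ≤ 1 := by
  rw [div_le_one (by positivity)]
  exact_mod_cast mismatches_le x y n

theorem freq_le (x y : ℤ → A) :
    IsBoundedUnder (· ≤ ·) atTop (fun n : ℕ => (mismatches x y n : ℝ) / (2 * n + 1)) :=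
  isBoundedUnder_of ⟨1, freq_le_one x y⟩

theorem freq_ge (x y : ℤ → A) :
    IsBoundedUnder (· ≥ ·) atTop (fun n : ℕ => (mismatches x y n : ℝ) / (2 * n + 1)) :=
  isBoundedUnder_of ⟨0, freq_nonneg x y⟩

theorem d1_self (x : ℤ → A) : d1 x x = 0 := by
  simp [d1, mismatches]

theorem d1_comm (x y : ℤ → A) : d1 x y = d1 y x := by
  have h : mismatches x y = mismatches y x := by
    funext n
    unfold mismatches
    congr 1
    ext i
    simp only [Finset.mem_filter, ne_comm]
  simp only [d1, h]

theorem mismatches_triangle (x y z : ℤ → A) (n : ℕ) :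
    mismatches x z n ≤ mismatches x y n + mismatches y z n := by
  classical
  unfold mismatches
  refine le_trans (Finset.card_le_card ?_) (Finset.card_union_le _ _)
  intro i hi
  simp only [Finset.mem_union, Finset.mem_filter] at hi ⊢
  by_cases h : x i = y i
  · exact Or.inr ⟨hi.1, h ▸ hi.2⟩
  · exact Or.inl ⟨hi.1, h⟩

theorem d1_triangle (x y z : ℤ → A) : d1 x z ≤ d1 x y + d1 y z := by
  unfold d1
  refine le_trans (limsup_le_limsup (Eventually.of_forall ?_)
    (freq_ge x z).isCoboundedUnder_le ?_) (limsup_add_le (freq_ge x y) (freq_le x y)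
      (freq_ge y z).isCoboundedUnder_le (freq_le y z))
  · intro n
    simp only [Pi.add_apply]
    rw [← add_div]
    gcongr
    exact_mod_cast mismatches_triangle x y z n
  · exact isBoundedUnder_le_add (freq_le x y) (freq_le y z)

theorem tendsto_inv_window : Tendsto (fun n : ℕ => (1 : ℝ) / (2 * n + 1)) atTop (𝓝 0) := by
  refine squeeze_zero (fun n => by positivity) (fun n => ?_)
    (tendsto_one_div_add_atTop_nhds_zero_nat (𝕜 := ℝ))
  gcongr
  have : (0 : ℝ) ≤ n := by positivity
  linarith

theorem d1_le_of_mismatches_le {x y u v : ℤ → A}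
    (h : ∀ n, mismatches u v n ≤ mismatches x y n + 1) : d1 u v ≤ d1 x y := by
  have hw := tendsto_inv_window
  have key : d1 u v ≤ d1 x y + limsup (fun n : ℕ => (1 : ℝ) / (2 * n + 1)) atTop := by
    unfold d1
    refine le_trans (limsup_le_limsup (Eventually.of_forall ?_)
      (freq_ge u v).isCoboundedUnder_le ?_) (limsup_add_le (freq_ge x y) (freq_le x y)
        hw.isBoundedUnder_ge.isCoboundedUnder_le hw.isBoundedUnder_le)
    · intro n
      simp only [Pi.add_apply]
      rw [← add_div]
      gcongr
      exact_mod_cast h n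
    · exact isBoundedUnder_le_add (freq_le x y) hw.isBoundedUnder_le
  rwa [hw.limsup_eq, add_zero] at key

theorem d1_shift (x y : ℤ → A) : d1 (shift A x) (shift A y) = d1 x y := by
  classical
  refine le_antisymm (d1_le_of_mismatches_le fun n => ?_) (d1_le_of_mismatches_le fun n => ?_)
  · unfold mismatches
    refine le_trans ?_ (Finset.card_insert_le ((n : ℤ) + 1) _)
    refine Finset.card_le_card_of_injOn (fun i => i + 1) ?_ (fun a _ b _ h => by simpa using h)
    intro i hi
    obtain ⟨hi, hne⟩ := Finset.mem_filter.1 (Finset.mem_coe.1 hi)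
    rw [Finset.mem_Icc] at hi
    beta_reduce
    rw [Finset.mem_coe, Finset.mem_insert, Finset.mem_filter, Finset.mem_Icc]
    by_cases hn : i = n
    · left; omega
    · right; exact ⟨by omega, hne⟩
  · unfold mismatches
    refine le_trans ?_ (Finset.card_insert_le (-(n : ℤ) - 1) _)
    refine Finset.card_le_card_of_injOn (fun i => i - 1) ?_ (fun a _ b _ h => by simpa using h)
    intro i hi
    obtain ⟨hi, hne⟩ := Finset.mem_filter.1 (Finset.mem_coe.1 hi)
    rw [Finset.mem_Icc] at hi
    beta_reduce
    rw [Finset.mem_coe, Finset.mem_insert, Finset.mem_filter, Finset.mem_Icc]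
    by_cases hn : i = -n
    · left; omega
    · right; exact ⟨by omega, by simpa [shift] using hne⟩

theorem measurable_d1 [MeasurableSpace A] [DiscreteMeasurableSpace A] (y : ℤ → A) :
    Measurable (fun x : ℤ → A => d1 x y) := by
  classical
  unfold d1
  refine Measurable.limsup fun n => Measurable.div_const ?_ _
  unfold mismatches
  simp only [Finset.card_filter, Nat.cast_sum]
  refine Finset.measurable_fun_sum _ fun i _ => ?_
  have hs : MeasurableSet {x : ℤ → A | x i ≠ y i} :=
    (measurable_pi_apply (X := fun _ : ℤ => A) i) (MeasurableSet.of_discrete (s := {a | a ≠ y i}))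
  exact (measurable_of_countable (fun k : ℕ => (k : ℝ))).comp
    (Measurable.ite hs measurable_const measurable_const)

end PseudoMetric

/-- Two-sided sequences, as a pseudo-metric space for `d1`. -/
def PreSpace (A : Type*) : Type _ := ℤ → A

noncomputable instance (A : Type*) : PseudoMetricSpace (PreSpace A) where
  dist x y := d1 (A := A) x y
  dist_self := d1_self
  dist_comm := d1_comm
  dist_triangle := d1_triangle

/-- The Besicovitch space: the quotient of `A^ℤ` by the relation `d1 x y = 0`, with the metric
induced by `d1`. -/
def Space (A : Type*) : Type _ := SeparationQuotient (PreSpace A)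

noncomputable instance (A : Type*) : MetricSpace (Space A) :=
  inferInstanceAs (MetricSpace (SeparationQuotient (PreSpace A)))

/-- The σ-algebra on the Besicovitch space generated by the open balls. -/
instance (A : Type*) : MeasurableSpace (Space A) :=
  MeasurableSpace.generateFrom {B | ∃ (u : Space A) (r : ℝ), B = Metric.ball u r}

/-- The quotient map from sequences to the Besicovitch space. -/
noncomputable def proj {A : Type*} (x : ℤ → A) : Space A := SeparationQuotient.mk (X := PreSpace A) x

theorem dist_proj {A : Type*} (x y : ℤ → A) : dist (proj x) (proj y) = d1 x y := rfl

theorem proj_surjective {A : Type*} : Function.Surjective (proj (A := A)) :=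
  SeparationQuotient.surjective_mk (X := PreSpace A)

theorem proj_eq_iff {A : Type*} {x y : ℤ → A} : proj x = proj y ↔ d1 x y = 0 := by
  rw [← dist_eq_zero, dist_proj]

theorem measurable_proj {A : Type*} [MeasurableSpace A] [DiscreteMeasurableSpace A] :
    Measurable (proj (A := A)) := by
  refine measurable_generateFrom ?_
  rintro _ ⟨u, r, rfl⟩
  obtain ⟨y, rfl⟩ := proj_surjective u
  exact measurableSet_lt (measurable_d1 y) measurable_const

theorem d1_shift_symm {A : Type*} (x y : ℤ → A) :
    d1 ((shift A).symm x) ((shift A).symm y) = d1 x y := by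
  rw [← d1_shift ((shift A).symm x), Equiv.apply_symm_apply, Equiv.apply_symm_apply]

/-- The map of the Besicovitch space induced by a `d1`-preserving map of sequences. -/
noncomputable def induced {A : Type*} (F : (ℤ → A) → (ℤ → A)) (hF : ∀ x y, d1 (F x) (F y) = d1 x y) :
    Space A → Space A :=
  SeparationQuotient.lift (X := PreSpace A) (fun x : PreSpace A => proj (F x)) fun x y h =>
    proj_eq_iff.2 ((hF x y).trans (Metric.inseparable_iff.1 h))

/-- The shift `σ̃` on the Besicovitch space, characterized by `σ̃ (proj x) = proj (σ x)`. -/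
noncomputable def shiftB (A : Type*) : Equiv.Perm (Space A) where
  toFun := induced (shift A) d1_shift
  invFun := induced (shift A).symm d1_shift_symm
  left_inv u := by
    obtain ⟨x, rfl⟩ := proj_surjective u
    exact congrArg proj ((shift A).symm_apply_apply x)
  right_inv u := by
    obtain ⟨x, rfl⟩ := proj_surjective u
    exact congrArg proj ((shift A).apply_symm_apply x)

theorem shiftB_proj {A : Type*} (x : ℤ → A) : shiftB A (proj x) = proj (shift A x) := rfl

/-- The two-sided orbit of a point of the Besicovitch space. -/
noncomputable def orbitB {A : Type*} (u : Space A) : Set (Space A) :=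
  Set.range fun n : ℤ => (shiftB A ^ n) u

/-- The restriction of the quotient map to `X`, as a map onto its image. -/
noncomputable def projOn {A : Type*} (X : Set (ℤ → A)) (x : X) : (proj '' X : Set (Space A)) :=
  ⟨proj x, Set.mem_image_of_mem proj x.2⟩

/-- The measure `μ ∘ proj⁻¹`, as a measure on the subset `proj '' X` of the Besicovitch space. -/
noncomputable def pushMeasure {A : Type*} [MeasurableSpace A] (μ : Measure (ℤ → A))
    (X : Set (ℤ → A)) : Measure (proj '' X : Set (Space A)) :=
  (μ.map proj).comap Subtype.val

/-- Minimality: no closed invariant subsets besides `∅` and the (nonempty) whole space. -/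
def IsMinimalSystem {Y : Type*} [TopologicalSpace Y] (T : Y → Y) : Prop :=
  Nonempty Y ∧ ∀ C : Set Y, IsClosed C → Set.MapsTo T C C → C = ∅ ∨ C = Set.univ

/-- `m` is a `T`-invariant probability measure and there is no other. -/
def IsUniquelyErgodic {Y : Type*} [MeasurableSpace Y] (T : Y → Y) (m : Measure Y) : Prop :=
  IsProbabilityMeasure m ∧ MeasurePreserving T m m ∧
    ∀ ν : Measure Y, IsProbabilityMeasure ν → MeasurePreserving T ν ν → ν = m

/-- `e` is an `L²`-eigenfunction of `(Y, T, m)` with eigenvalue `ξ`. -/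
structure IsEigenfunction {Y : Type*} [MeasurableSpace Y] (T : Y → Y) (m : Measure Y)
    (ξ : ℂ) (e : Y → ℂ) : Prop where
  memLp : MemLp e 2 m
  ne_zero : ¬ e =ᵐ[m] 0
  eigen : ∀ᵐ y ∂m, e (T y) = ξ * e y

end Besicovitch

open Besicovitch

/-! `D1` is shift-invariant in each variable separately, so ergodicity, used once per variable,
makes it almost surely constant. Since the induced shift is an isometry, orbit closures partition
the Besicovitch space, and `D1 x y = 0` says that `proj x` and `proj y` lie in the same one. If the
constant is 0, Fubini yields a generic point whose class X has full measure. Genericity spreads over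
X: a continuous function almost depends on finitely many coordinates, so its Birkhoff averages are
asymptotically stable under small `d1` changes. That almost every point is generic is Birkhoff's
theorem, derived here from a maximal-sum argument.

Compactness is a packing argument. Balls of radius r around the points of the orbit all have the
same measure, and it is positive because countably many of them cover almost everything. A finite
measure admits only finitely many disjoint ones, so the orbit is totally bounded; the space is
complete by Besicovitch's gluing construction (`exists_d1_limit`).

The rest concerns compact isometric systems. Recurrence upgrades dense two-sided orbits to dense
forward orbits, whence minimality. Averaging against a tent kernel replaces convolution on a compact
group: for every invariant measure the mean of the kernel is independent of its centre, and Fubini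
then forces two invariant probability measures to coincide (`isUniquelyErgodic_of_isometry`).
Smoothing an eigenfunction e by a kernel gives a continuous eigenfunction G of constant modulus,
nonzero for some radius; e / G is invariant, hence constant almost everywhere
(`IsEigenfunction.exists_continuous`). -/

namespace Besicovitch

/-! ### Maximal Birkhoff sums. -/

section MaxSum

variable {α : Type*} {T : α → α} {f : α → ℝ}

/-- The running maximum of the Birkhoff sums of `f`, including the empty sum. -/
noncomputable def maxSum (T : α → α) (f : α → ℝ) : ℕ → α → ℝ
  | 0 => fun _ => 0
  | n + 1 => fun x => max 0 (f x + maxSum T f n (T x))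

theorem maxSum_nonneg (n : ℕ) (x : α) : 0 ≤ maxSum T f n x := by
  cases n with
  | zero => exact le_rfl
  | succ n => exact le_max_left _ _

theorem maxSum_mono (x : α) : Monotone fun n => maxSum T f n x := by
  refine monotone_nat_of_le_succ fun n => ?_
  induction n generalizing x with
  | zero => exact maxSum_nonneg 1 x
  | succ n ih => exact max_le_max le_rfl (add_le_add_right (ih (T x)) _)

theorem birkhoffSum_le_maxSum (n : ℕ) (x : α) : birkhoffSum T f n x ≤ maxSum T f n x := by
  induction n generalizing x with
  | zero => simp [maxSum]
  | succ n ih =>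
    rw [birkhoffSum_succ']
    exact (add_le_add_right (ih (T x)) _).trans (le_max_right _ _)

/-- The recursion bounds each supremum by the other up to a shift by f x. The set of points with
bounded sums is therefore strictly invariant, as ergodicity requires. -/
theorem bddAbove_maxSum_iff (x : α) :
    BddAbove (Set.range fun n => maxSum T f n (T x)) ↔
      BddAbove (Set.range fun n => maxSum T f n x) := by
  constructor
  · rintro ⟨C, hC⟩
    refine ⟨max 0 (f x + C), ?_⟩
    rintro _ ⟨n, rfl⟩
    refine (maxSum_mono x n.le_succ).trans (max_le_max le_rfl (add_le_add_right ?_ _))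
    exact hC ⟨n, rfl⟩
  · rintro ⟨C, hC⟩
    refine ⟨C - f x, ?_⟩
    rintro _ ⟨n, rfl⟩
    have h : maxSum T f (n + 1) x ≤ C := hC ⟨n + 1, rfl⟩
    have := (le_max_right _ _).trans h
    simp only
    linarith

end MaxSum

/-- Reduces two-sided averages to one-sided ones for S and its inverse; the term k = 0 belongs to
both and is subtracted once. -/
theorem sum_Icc_zpow {α M : Type*} [AddCommGroup M] (S : Equiv.Perm α) (g : α → M) (x : α) (n : ℕ) :
    ∑ k ∈ Finset.Icc (-(n : ℤ)) n, g ((S ^ k) x) =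
      birkhoffSum S g (n + 1) x + birkhoffSum S.symm g (n + 1) x - g x := by
  induction n with
  | zero => simp [birkhoffSum]
  | succ n ih =>
    have hI : Finset.Icc (-((n + 1 : ℕ) : ℤ)) (n + 1 : ℕ) =
        insert ((n + 1 : ℕ) : ℤ) (insert (-((n + 1 : ℕ) : ℤ)) (Finset.Icc (-(n : ℤ)) n)) := by
      ext i
      simp only [Finset.mem_insert, Finset.mem_Icc]
      omega
    rw [hI, Finset.sum_insert, Finset.sum_insert, ih, birkhoffSum_succ S g (n + 1),
      birkhoffSum_succ S.symm g (n + 1)]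
    · rw [Equiv.Perm.iterate_eq_pow, Equiv.Perm.iterate_eq_pow, zpow_neg, zpow_natCast,
        ← Equiv.Perm.inv_def, inv_pow]
      abel
    · simp only [Finset.mem_Icc]; omega
    · simp only [Finset.mem_insert, Finset.mem_Icc]; omega

/-! ### The pointwise ergodic theorem. -/

section ErgodicTheorem

variable {α : Type*} [MeasurableSpace α] {μ : Measure α} {T : α → α} {f : α → ℝ}

theorem integral_comp_of_measurePreserving {β E : Type*} [MeasurableSpace β]
    [NormedAddCommGroup E] [NormedSpace ℝ E] {ν : Measure β} {φ : α → β}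
    (hφ : MeasurePreserving φ μ ν) {g : β → E} (hg : AEStronglyMeasurable g ν) :
    ∫ x, g (φ x) ∂μ = ∫ y, g y ∂ν := by
  rw [← hφ.map_eq, integral_map hφ.measurable.aemeasurable (hφ.map_eq ▸ hg)]

theorem measurable_maxSum (hT : Measurable T) (hf : Measurable f) (n : ℕ) :
    Measurable (maxSum T f n) := by
  induction n with
  | zero => exact measurable_const
  | succ n ih => exact measurable_const.max (hf.add (ih.comp hT))

theorem integrable_maxSum (hT : MeasurePreserving T μ μ) (hf : Integrable f μ) (n : ℕ) :
    Integrable (maxSum T f n) μ := by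
  induction n with
  | zero => exact integrable_zero _ _ _
  | succ n ih =>
    exact (integrable_zero _ _ _).sup (hf.add (hT.integrable_comp_of_integrable ih))

/-- The Birkhoff sums of a function with negative integral are bounded above. -/
theorem ae_bddAbove_birkhoffSum (hT : Ergodic T μ) (hf : Measurable f)
    (hfi : Integrable f μ) (hneg : ∫ x, f x ∂μ < 0) :
    ∀ᵐ x ∂μ, ∃ C, ∀ n, birkhoffSum T f n x ≤ C := by
  have hTm := hT.toMeasurePreserving
  have hE : MeasurableSet {x | BddAbove (Set.range fun n => maxSum T f n x)} :=
    measurableSet_bddAbove_range fun n => measurable_maxSum hTm.measurable hf n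
  rcases hT.toPreErgodic.ae_mem_or_ae_notMem hE (Set.ext fun x => bddAbove_maxSum_iff x) with h | h
  · filter_upwards [h] with x ⟨C, hC⟩
    exact ⟨C, fun n => (birkhoffSum_le_maxSum n x).trans (hC ⟨n, rfl⟩)⟩
  exfalso
  have hI := integrable_maxSum hTm hfi
  have hD : ∀ n x, maxSum T f (n + 1) x - maxSum T f n (T x) = max (-maxSum T f n (T x)) (f x) := by
    intro n x
    change max 0 (f x + maxSum T f n (T x)) - _ = _
    rw [← max_sub_sub_right]
    simp
  -- If the sums are unbounded almost everywhere, the increment in `hD` is eventually f x, and it is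
  -- always dominated by |f|.
  have hlim : Tendsto (fun n => ∫ x, (maxSum T f (n + 1) x - maxSum T f n (T x)) ∂μ) atTop
      (𝓝 (∫ x, f x ∂μ)) := by
    refine tendsto_integral_of_dominated_convergence (fun x => |f x|) (fun n => ?_) hfi.abs
      (fun n => ae_of_all _ fun x => ?_) ?_
    · exact ((hI (n + 1)).sub (hTm.integrable_comp_of_integrable (hI n))).aestronglyMeasurable
    · rw [hD, Real.norm_eq_abs, abs_le]
      have := maxSum_nonneg (T := T) (f := f) n (T x)
      exact ⟨(neg_abs_le _).trans (le_max_right _ _),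
        max_le ((neg_nonpos.2 this).trans (abs_nonneg _)) (le_abs_self _)⟩
    · filter_upwards [h] with x hx
      have hx' : ¬ BddAbove (Set.range fun n => maxSum T f n (T x)) :=
        fun hb => hx ((bddAbove_maxSum_iff x).1 hb)
      have hu := tendsto_atTop_atTop_of_monotone' (maxSum_mono (T x)) hx'
      refine tendsto_const_nhds.congr' ?_
      filter_upwards [hu.eventually_ge_atTop (-f x)] with n hn
      rw [hD, max_eq_right (by linarith)]
  -- By invariance and monotonicity of the maximal sums, every integral in the sequence is
  -- nonnegative, so its limit cannot be negative.
  refine hneg.not_ge (ge_of_tendsto' hlim fun n => ?_)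
  have hsub : ∫ x, (maxSum T f (n + 1) x - maxSum T f n (T x)) ∂μ =
      ∫ x, maxSum T f (n + 1) x ∂μ - ∫ x, maxSum T f n x ∂μ := by
    rw [← integral_comp_of_measurePreserving hTm (hI n).aestronglyMeasurable]
    exact integral_sub (hI (n + 1)) (hTm.integrable_comp_of_integrable (hI n))
  rw [hsub]
  exact sub_nonneg.2 (integral_mono (hI n) (hI (n + 1)) fun x => maxSum_mono x n.le_succ)

theorem ae_birkhoffSum_le [IsProbabilityMeasure μ] (hT : Ergodic T μ) (hf : Measurable f)
    (hfi : Integrable f μ) {c : ℝ} (hc : ∫ x, f x ∂μ < c) :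
    ∀ᵐ x ∂μ, ∃ C, ∀ n : ℕ, birkhoffSum T f n x ≤ C + n * c := by
  have h := ae_bddAbove_birkhoffSum hT (hf.sub_const c) (hfi.sub (integrable_const c)) (by
    rw [integral_sub hfi (integrable_const c)]; simpa using hc)
  filter_upwards [h] with x ⟨C, hC⟩
  refine ⟨C, fun n => ?_⟩
  have := hC n
  simp only [birkhoffSum, Finset.sum_sub_distrib, Finset.sum_const, Finset.card_range,
    nsmul_eq_mul] at this ⊢
  linarith

/-- Birkhoff's pointwise ergodic theorem for an ergodic map, in an additive form. -/
theorem ae_abs_birkhoffSum_sub_le [IsProbabilityMeasure μ] (hT : Ergodic T μ) (hf : Measurable f)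
    (hfi : Integrable f μ) :
    ∀ᵐ x ∂μ, ∀ m : ℕ, ∃ C, ∀ n : ℕ,
      |birkhoffSum T f n x - n * ∫ x, f x ∂μ| ≤ C + n * (1 / ((m : ℝ) + 1)) := by
  rw [ae_all_iff]
  intro m
  have hm : (0 : ℝ) < 1 / ((m : ℝ) + 1) := by positivity
  have h1 := ae_birkhoffSum_le hT hf hfi (lt_add_of_pos_right _ hm)
  have h2 := ae_birkhoffSum_le hT hf.neg hfi.neg (c := -∫ x, f x ∂μ + 1 / ((m : ℝ) + 1)) (by
    have : ∫ x, (-f) x ∂μ = -∫ x, f x ∂μ := integral_neg f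
    linarith)
  filter_upwards [h1, h2] with x ⟨C₁, h₁⟩ ⟨C₂, h₂⟩
  refine ⟨max C₁ C₂, fun n => ?_⟩
  have e₁ := h₁ n
  have e₂ := h₂ n
  have e₃ : birkhoffSum T (-f) n x = -birkhoffSum T f n x := by simp [birkhoffSum]
  rw [e₃] at e₂
  rw [mul_add] at e₁ e₂
  rw [abs_le]
  constructor
  · linarith [le_max_right C₁ C₂]
  · linarith [le_max_left C₁ C₂]

/-- The two-sided pointwise ergodic theorem for real functions. -/
theorem ae_tendsto_twoSided_real [IsProbabilityMeasure μ] (S : α ≃ᵐ α) (hS : Ergodic S μ)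
    (hf : Measurable f) (hfi : Integrable f μ) :
    ∀ᵐ x ∂μ, Tendsto (fun n : ℕ => (1 / (2 * n + 1) : ℝ) *
      ∑ k ∈ Finset.Icc (-(n : ℤ)) n, f (((S.toEquiv : Equiv.Perm α) ^ k) x))
      atTop (𝓝 (∫ x, f x ∂μ)) := by
  filter_upwards [ae_abs_birkhoffSum_sub_le hS hf hfi, ae_abs_birkhoffSum_sub_le hS.symm hf hfi]
    with x h₁ h₂
  set I := ∫ x, f x ∂μ
  rw [Metric.tendsto_atTop]
  intro ε hε
  obtain ⟨m, hm⟩ := exists_nat_one_div_lt (half_pos hε)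
  obtain ⟨C₁, h₁⟩ := h₁ m
  obtain ⟨C₂, h₂⟩ := h₂ m
  -- The two one-sided errors grow by at most 2(n + 1) · ε/2 = (2n + 1) · ε/2 + ε/2; the last ε/2
  -- joins the constants.
  have hw := (tendsto_inv_window.mul_const (C₁ + C₂ + |I - f x| + ε / 2)).eventually_lt_const
    (show 0 * _ < ε / 2 by rw [zero_mul]; exact half_pos hε)
  obtain ⟨N, hN⟩ := eventually_atTop.1 hw
  refine ⟨N, fun n hn => ?_⟩
  have hn := hN n hn
  have hpos : (0 : ℝ) < 2 * n + 1 := by positivity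
  rw [one_div_mul_eq_div, div_lt_iff₀ hpos] at hn
  have e₁ := h₁ (n + 1)
  have e₂ := h₂ (n + 1)
  rw [sum_Icc_zpow, Real.dist_eq]
  change |birkhoffSum S f (n + 1) x - _| ≤ _ at e₁
  change |birkhoffSum S.symm f (n + 1) x - _| ≤ _ at e₂
  change |1 / (2 * (n : ℝ) + 1) * (birkhoffSum S f (n + 1) x + birkhoffSum S.symm f (n + 1) x - f x)
    - I| < ε
  set a := birkhoffSum S f (n + 1) x
  set b := birkhoffSum S.symm f (n + 1) x
  have hrw : 1 / (2 * (n : ℝ) + 1) * (a + b - f x) - I =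
      ((a - (n + 1 : ℕ) * I) + (b - (n + 1 : ℕ) * I) + (I - f x)) / (2 * n + 1) := by
    field_simp
    push_cast
    ring
  rw [hrw, abs_div, abs_of_pos hpos, div_lt_iff₀ hpos]
  refine (abs_add_three _ _ _).trans_lt ?_
  have : (n + 1 : ℕ) * (1 / ((m : ℝ) + 1)) ≤ (n + 1 : ℕ) * (ε / 2) := by gcongr
  push_cast at this e₁ e₂ ⊢
  nlinarith

/-- The two-sided pointwise ergodic theorem for complex functions. -/
theorem ae_tendsto_twoSided [IsProbabilityMeasure μ] (S : α ≃ᵐ α) (hS : Ergodic S μ)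
    {g : α → ℂ} (hg : Measurable g) (hgi : Integrable g μ) :
    ∀ᵐ x ∂μ, Tendsto (fun n : ℕ => (1 / (2 * n + 1) : ℂ) *
      ∑ k ∈ Finset.Icc (-(n : ℤ)) n, g (((S.toEquiv : Equiv.Perm α) ^ k) x))
      atTop (𝓝 (∫ x, g x ∂μ)) := by
  filter_upwards [ae_tendsto_twoSided_real S hS (Complex.measurable_re.comp hg) hgi.re,
    ae_tendsto_twoSided_real S hS (Complex.measurable_im.comp hg) hgi.im] with x h₁ h₂
  have h := ((Complex.continuous_ofReal.tendsto _).comp h₁).add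
    (((Complex.continuous_ofReal.tendsto _).comp h₂).mul_const Complex.I)
  have hI : ((∫ x, (Complex.re ∘ g) x ∂μ : ℝ) : ℂ) + ((∫ x, (Complex.im ∘ g) x ∂μ : ℝ) : ℂ) *
      Complex.I = ∫ x, g x ∂μ := integral_re_add_im hgi
  rw [hI] at h
  refine h.congr fun n => ?_
  simp only [Function.comp_apply]
  push_cast
  rw [mul_assoc, ← mul_add, Finset.sum_mul, ← Finset.sum_add_distrib]
  simp only [Complex.re_add_im]

end ErgodicTheorem

/-! ### Completeness of the Besicovitch space. -/

section Complete

variable {A : Type*}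

theorem d1_nonneg (x y : ℤ → A) : 0 ≤ d1 x y := dist_nonneg (α := PreSpace A) (x := x) (y := y)

theorem d1_le_of_eventually {x y : ℤ → A} {c : ℝ}
    (h : ∀ᶠ n : ℕ in atTop, (mismatches x y n : ℝ) ≤ c * (2 * n + 1)) : d1 x y ≤ c := by
  refine limsup_le_of_le (freq_ge x y).isCoboundedUnder_le (h.mono fun n hn => ?_)
  rwa [div_le_iff₀ (by positivity)]

theorem eventually_mismatches_le {x y : ℤ → A} {c : ℝ} (h : d1 x y < c) :
    ∀ᶠ n : ℕ in atTop, (mismatches x y n : ℝ) ≤ c * (2 * n + 1) := by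
  filter_upwards [eventually_lt_of_limsup_lt h (freq_le x y)] with n hn
  rw [div_lt_iff₀ (by positivity)] at hn
  exact hn.le

theorem mismatches_le_of_glue {x u v z : ℤ → A} {m n : ℕ}
    (h : ∀ i : ℤ, i.natAbs ≤ n → m ≤ i.natAbs → z i = u i ∨ z i = v i) :
    mismatches x z n ≤ (2 * m + 1) + mismatches x u n + mismatches x v n := by
  classical
  have hm : (Finset.Icc (-(m : ℤ)) m).card = 2 * m + 1 := by
    rw [Int.card_Icc]; omega
  rw [← hm]
  unfold mismatches
  refine le_trans (Finset.card_le_card ?_)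
    ((Finset.card_union_le _ _).trans (Nat.add_le_add_right (Finset.card_union_le _ _) _))
  intro i hi
  simp only [Finset.mem_union, Finset.mem_filter, Finset.mem_Icc] at hi ⊢
  by_cases him : m ≤ i.natAbs
  · rcases h i (by omega) him with h | h
    · exact Or.inl (Or.inr ⟨hi.1, h ▸ hi.2⟩)
    · exact Or.inr ⟨hi.1, h ▸ hi.2⟩
  · exact Or.inl (Or.inl (by omega))

/-- Scales along which the sequences `x k` can be glued. -/
theorem exists_gluing_scales {x : ℕ → ℤ → A} {c : ℕ → ℝ} (hc : ∀ k, 0 < c k)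
    (hx : ∀ j k, j ≤ k → d1 (x j) (x k) < c j) :
    ∃ N : ℕ → ℕ, StrictMono N ∧
      (∀ j k n, j ≤ k → N k ≤ n → (mismatches (x j) (x k) n : ℝ) ≤ c j * (2 * n + 1)) ∧
      ∀ k n, N (k + 1) ≤ n → (2 * N k + 1 : ℝ) ≤ c k * (2 * n + 1) := by
  have h1 : ∀ k, ∃ M : ℕ, ∀ n, M ≤ n → ∀ j ≤ k,
      (mismatches (x j) (x k) n : ℝ) ≤ c j * (2 * n + 1) := by
    intro k
    refine eventually_atTop.1 (((Set.finite_Iic k).eventually_all).2 fun j hj => ?_)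
    exact eventually_mismatches_le (hx j k hj)
  choose M hM using h1
  have h2 : ∀ k m : ℕ, ∃ P : ℕ, ∀ n, P ≤ n → (2 * m + 1 : ℝ) ≤ c k * (2 * n + 1) := by
    intro k m
    obtain ⟨P, hP⟩ := exists_nat_ge ((2 * m + 1) / c k)
    refine ⟨P, fun n hn => ?_⟩
    rw [div_le_iff₀ (hc k)] at hP
    have : (P : ℝ) ≤ n := by exact_mod_cast hn
    nlinarith [hc k]
  choose P hP using h2
  let N : ℕ → ℕ := fun k => Nat.rec (M 0) (fun k m => max (m + 1) (max (M (k + 1)) (P k m))) k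
  have hN : ∀ k, N (k + 1) = max (N k + 1) (max (M (k + 1)) (P k (N k))) := fun k => rfl
  refine ⟨N, strictMono_nat_of_lt_succ fun k => ?_, fun j k n hjk hn => ?_, fun k n hn => ?_⟩
  · rw [hN]; omega
  · refine hM k n (le_trans ?_ hn) j hjk
    cases k with
    | zero => exact le_rfl
    | succ k => rw [hN]; omega
  · exact hP k (N k) n (by rw [hN] at hn; omega)

/-- Besicovitch: a fast `d1`-Cauchy sequence has a limit, obtained by gluing. -/
theorem exists_d1_limit {x : ℕ → ℤ → A} {c : ℕ → ℝ} (hc : ∀ k, 0 < c k) (hanti : Antitone c)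
    (hx : ∀ j k, j ≤ k → d1 (x j) (x k) < c j) : ∃ z, ∀ j, d1 (x j) z ≤ 3 * c j := by
  obtain ⟨N, hNm, hN, hNs⟩ := exists_gluing_scales hc hx
  -- The glued point copies x k on the shell N k ≤ |i| < N (k + 1). Searching up to i suffices
  -- because k ≤ N k.
  let κ : ℕ → ℕ := fun i => Nat.findGreatest (fun k => N k ≤ i) i
  have hκ : ∀ k i, N k ≤ i → i < N (k + 1) → κ i = k := by
    intro k i h1 h2
    have hk : k ≤ κ i := Nat.le_findGreatest ((hNm.id_le k).trans h1) h1
    have hs : N (κ i) ≤ i := Nat.findGreatest_spec (P := fun k => N k ≤ i) ((hNm.id_le k).trans h1) h1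
    have := hNm.lt_iff_lt.1 (hs.trans_lt h2)
    omega
  refine ⟨fun i => x (κ i.natAbs) i, fun j => d1_le_of_eventually ?_⟩
  filter_upwards [eventually_ge_atTop (N (j + 1))] with n hn
  have hk1 : j + 1 ≤ κ n := Nat.le_findGreatest ((hNm.id_le _).trans hn) hn
  obtain ⟨k, hk⟩ : ∃ k, κ n = k + 1 := ⟨κ n - 1, by omega⟩
  have hkn : N (k + 1) ≤ n := by
    rw [← hk]
    exact Nat.findGreatest_spec (P := fun k => N k ≤ n) ((hNm.id_le _).trans hn) hn
  have hkn' : n < N (k + 2) := by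
    by_contra! h
    have : k + 2 ≤ κ n := Nat.le_findGreatest ((hNm.id_le _).trans h) h
    omega
  -- For N (k + 1) ≤ n < N (k + 2), only x k and x (k + 1) are used between radius N k and n. The
  -- core and these two pieces each cost at most c j (2n + 1), whence the factor 3.
  have hg := mismatches_le_of_glue (x := x j) (u := x k) (v := x (k + 1))
    (z := fun i => x (κ i.natAbs) i) (m := N k) (n := n) (by
      intro i hi1 hi2
      by_cases h : i.natAbs < N (k + 1)
      · left; simp only [hκ k _ hi2 h]
      · right; simp only [hκ (k + 1) _ (not_lt.1 h) (hi1.trans_lt hkn')])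
  have hg' : (mismatches (x j) (fun i => x (κ i.natAbs) i) n : ℝ) ≤
      (2 * N k + 1) + mismatches (x j) (x k) n + mismatches (x j) (x (k + 1)) n := by
    exact_mod_cast hg
  have e1 := hNs k n hkn
  have e2 := hN j k n (by omega) ((hNm k.lt_succ_self).le.trans hkn)
  have e3 := hN j (k + 1) n (by omega) hkn
  have e4 : c k * (2 * n + 1) ≤ c j * (2 * n + 1) := by
    gcongr
    exact hanti (by omega)
  linarith

instance : CompleteSpace (PreSpace A) := by
  refine Metric.complete_of_convergent_controlled_sequences (fun n => (1 / 2 : ℝ) ^ n) (by simp) ?_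
  intro u hu
  obtain ⟨z, hz⟩ := exists_d1_limit (A := A) (x := u) (c := fun n => (1 / 2 : ℝ) ^ n) (by simp)
    (pow_right_anti₀ (by norm_num) (by norm_num)) fun j k hjk => hu j j k le_rfl hjk
  refine ⟨z, tendsto_iff_dist_tendsto_zero.2 (squeeze_zero (fun _ => dist_nonneg) hz ?_)⟩
  simpa using (tendsto_pow_atTop_nhds_zero_of_lt_one (r := (1 / 2 : ℝ)) (by norm_num)
    (by norm_num)).const_mul 3

instance : CompleteSpace (Space A) :=
  inferInstanceAs (CompleteSpace (SeparationQuotient (PreSpace A)))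

end Complete

/-! ### Orbit closures and the relation `D1 x y = 0`. -/

section Orbit

variable {A : Type*}

theorem shiftB_dist (u v : Space A) : dist (shiftB A u) (shiftB A v) = dist u v := by
  obtain ⟨x, rfl⟩ := proj_surjective u
  obtain ⟨y, rfl⟩ := proj_surjective v
  exact d1_shift x y

theorem shiftB_zpow_dist (n : ℤ) (u v : Space A) :
    dist ((shiftB A ^ n) u) ((shiftB A ^ n) v) = dist u v := by
  induction n generalizing u v with
  | zero => simp
  | succ n ih => rw [zpow_add_one, Equiv.Perm.mul_apply, Equiv.Perm.mul_apply, ih, shiftB_dist]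
  | pred n ih =>
    rw [zpow_sub_one, Equiv.Perm.mul_apply, Equiv.Perm.mul_apply, ih,
      ← shiftB_dist ((shiftB A)⁻¹ u)]
    simp

theorem shiftB_zpow_proj (n : ℤ) (x : ℤ → A) :
    (shiftB A ^ n) (proj x) = proj ((shift A ^ n) x) := by
  induction n generalizing x with
  | zero => simp
  | succ n ih =>
    rw [zpow_add_one, zpow_add_one, Equiv.Perm.mul_apply, Equiv.Perm.mul_apply, shiftB_proj, ih]
  | pred n ih =>
    rw [zpow_sub_one, zpow_sub_one, Equiv.Perm.mul_apply, Equiv.Perm.mul_apply, ← ih]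
    congr 1

theorem d1_zpow (n : ℤ) (x y : ℤ → A) : d1 ((shift A ^ n) x) ((shift A ^ n) y) = d1 x y := by
  rw [← dist_proj, ← shiftB_zpow_proj, ← shiftB_zpow_proj, shiftB_zpow_dist, dist_proj]

theorem bddBelow_d1 (x y : ℤ → A) : BddBelow (Set.range fun n : ℤ => d1 x ((shift A ^ n) y)) :=
  ⟨0, by rintro _ ⟨n, rfl⟩; exact d1_nonneg _ _⟩

theorem D1_nonneg (x y : ℤ → A) : 0 ≤ D1 x y := le_ciInf fun _ => d1_nonneg _ _

theorem D1_le_one (x y : ℤ → A) : D1 x y ≤ 1 := by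
  refine (ciInf_le (bddBelow_d1 x y) 0).trans (d1_le_of_eventually (Eventually.of_forall fun n => ?_))
  rw [one_mul]
  exact_mod_cast mismatches_le _ _ n

theorem D1_shift_right (x y : ℤ → A) : D1 x (shift A y) = D1 x y := by
  unfold D1
  refine (Equiv.addRight (1 : ℤ)).iInf_congr fun n => ?_
  rw [Equiv.coe_addRight, zpow_add_one, Equiv.Perm.mul_apply]

theorem D1_shift_left (x y : ℤ → A) : D1 (shift A x) y = D1 x y := by
  unfold D1
  refine ((Equiv.addRight (1 : ℤ)).iInf_congr fun n => ?_).symm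
  change d1 (shift A x) ((shift A ^ (n + 1)) y) = _
  rw [add_comm, zpow_add, zpow_one, Equiv.Perm.mul_apply, d1_shift]

theorem closure_orbitB_subset {u v : Space A} (h : v ∈ closure (orbitB u)) :
    closure (orbitB v) ⊆ closure (orbitB u) := by
  refine closure_minimal ?_ isClosed_closure
  rintro _ ⟨n, rfl⟩
  rw [Metric.mem_closure_iff] at h ⊢
  intro ε hε
  obtain ⟨_, ⟨k, rfl⟩, hk⟩ := h ε hε
  refine ⟨(shiftB A ^ n) ((shiftB A ^ k) u), ⟨n + k, ?_⟩, ?_⟩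
  · simp [zpow_add]
  · simpa [shiftB_zpow_dist] using hk

/-- If the k-th shift of u is near v, then, by isometry, the (-k)-th shift of v is equally near u.
This symmetry is what makes orbit closures disjoint or equal. -/
theorem mem_closure_orbitB_comm {u v : Space A} (h : v ∈ closure (orbitB u)) :
    u ∈ closure (orbitB v) := by
  rw [Metric.mem_closure_iff] at h ⊢
  intro ε hε
  obtain ⟨_, ⟨k, rfl⟩, hk⟩ := h ε hε
  refine ⟨(shiftB A ^ (-k)) v, ⟨-k, rfl⟩, ?_⟩
  rw [← shiftB_zpow_dist k, dist_comm]
  simpa using hk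

theorem closure_orbitB_eq {u v : Space A} (h : v ∈ closure (orbitB u)) :
    closure (orbitB v) = closure (orbitB u) :=
  (closure_orbitB_subset h).antisymm (closure_orbitB_subset (mem_closure_orbitB_comm h))

theorem D1_eq_zero_iff {x y : ℤ → A} : D1 x y = 0 ↔ proj y ∈ closure (orbitB (proj x)) := by
  have h : D1 x y = 0 ↔ proj x ∈ closure (orbitB (proj y)) := by
    rw [Metric.mem_closure_iff]
    constructor
    · intro h ε hε
      obtain ⟨n, hn⟩ := exists_lt_of_ciInf_lt (f := fun n : ℤ => d1 x ((shift A ^ n) y))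
        (h.trans_lt hε : D1 x y < ε)
      exact ⟨(shiftB A ^ n) (proj y), ⟨n, rfl⟩, by rwa [shiftB_zpow_proj, dist_proj]⟩
    · intro h
      refine le_antisymm (le_of_forall_pos_le_add fun ε hε => ?_) (D1_nonneg x y)
      obtain ⟨_, ⟨n, rfl⟩, hn⟩ := h ε hε
      simp only [shiftB_zpow_proj, dist_proj] at hn
      exact (ciInf_le (bddBelow_d1 x y) n).trans (by linarith)
  exact h.trans ⟨mem_closure_orbitB_comm, mem_closure_orbitB_comm⟩

end Orbit

/-! ### Powers of the shift. -/

section Shift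

variable {A : Type*}

theorem shift_zpow_apply (n : ℤ) (x : ℤ → A) (i : ℤ) : (shift A ^ n) x i = x (i + n) := by
  induction n generalizing x with
  | zero => simp
  | succ n ih =>
    rw [zpow_add_one, Equiv.Perm.mul_apply, ih]
    exact congrArg x (by ring)
  | pred n ih =>
    rw [zpow_sub_one, Equiv.Perm.mul_apply, ih]
    exact congrArg x (by ring)

/-- The shift as a measurable equivalence. -/
def measurableShift (A : Type*) [MeasurableSpace A] : (ℤ → A) ≃ᵐ (ℤ → A) where
  toEquiv := shift A
  measurable_toFun := measurable_pi_lambda _ fun i => measurable_pi_apply (i + 1)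
  measurable_invFun := measurable_pi_lambda _ fun i => measurable_pi_apply (i - 1)

theorem measurePreserving_shift_zpow [MeasurableSpace A] {μ : Measure (ℤ → A)}
    (h : MeasurePreserving (shift A) μ μ) (n : ℤ) : MeasurePreserving (shift A ^ n) μ μ := by
  have h' : MeasurePreserving ((shift A)⁻¹ : Equiv.Perm (ℤ → A)) μ μ := MeasurePreserving.symm (measurableShift A) h
  cases n with
  | ofNat n =>
    rw [Int.ofNat_eq_natCast, zpow_natCast, ← Equiv.Perm.iterate_eq_pow]
    exact h.iterate n
  | negSucc n =>
    rw [zpow_negSucc, ← inv_pow, ← Equiv.Perm.iterate_eq_pow]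
    exact h'.iterate (n + 1)

end Shift

/-! ### Almost sure constancy of `D1`. -/

section ConstantDistance

variable {A : Type*} [Finite A] [MeasurableSpace A] [DiscreteMeasurableSpace A]

theorem measurable_d1_comp {β : Type*} [MeasurableSpace β] {f g : β → ℤ → A}
    (hf : Measurable f) (hg : Measurable g) : Measurable fun b => d1 (f b) (g b) := by
  classical
  unfold d1
  refine Measurable.limsup fun n => Measurable.div_const ?_ _
  unfold mismatches
  simp only [Finset.card_filter, Nat.cast_sum]
  refine Finset.measurable_fun_sum _ fun i _ => ?_
  have hs : MeasurableSet {b | f b i ≠ g b i} :=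
    (measurableSet_eq_fun ((measurable_pi_apply i).comp hf)
      ((measurable_pi_apply i).comp hg)).compl
  exact (measurable_of_countable (fun k : ℕ => (k : ℝ))).comp
    (Measurable.ite hs measurable_const measurable_const)

theorem measurable_D1_comp {β : Type*} [MeasurableSpace β] {f g : β → ℤ → A}
    (hf : Measurable f) (hg : Measurable g) : Measurable fun b => D1 (f b) (g b) := by
  unfold D1
  refine Measurable.iInf fun n => measurable_d1_comp hf (measurable_pi_lambda _ fun i => ?_)
  simp only [shift_zpow_apply]
  exact (measurable_pi_apply (i + n)).comp hg

theorem ae_D1_eq_const (μ : Measure (ℤ → A)) [IsProbabilityMeasure μ]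
    (hμ : Ergodic (shift A) μ) :
    ∃ c ∈ Set.Icc (0 : ℝ) 1, ∀ᵐ p ∂(μ.prod μ), D1 p.1 p.2 = c := by
  have hm : Measurable fun p : (ℤ → A) × (ℤ → A) => D1 p.1 p.2 :=
    measurable_D1_comp measurable_fst measurable_snd
  have hmx : ∀ x, Measurable fun y : ℤ → A => D1 x y := fun x =>
    measurable_D1_comp measurable_const measurable_id
  -- Writing the almost sure value of D1 x · as an integral makes it measurable in x, so ergodicity
  -- applies a second time; the product system need not be ergodic.
  let F : (ℤ → A) → ℝ := fun x => ∫ y, D1 x y ∂μ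
  have hx : ∀ x, ∀ᵐ y ∂μ, D1 x y = F x := by
    intro x
    obtain ⟨c, hc⟩ := hμ.toPreErgodic.ae_eq_const_of_ae_eq_comp (hmx x)
      (funext fun y => D1_shift_right x y)
    have : F x = c := by
      change ∫ y, D1 x y ∂μ = c
      rw [integral_congr_ae hc]
      simp
    filter_upwards [hc] with y hy
    rw [this]; exact hy
  have hF : Measurable F := (hm.stronglyMeasurable.integral_prod_right (ν := μ)).measurable
  obtain ⟨c, hc⟩ := hμ.toPreErgodic.ae_eq_const_of_ae_eq_comp hF
    (funext fun x => by simp only [F, Function.comp_apply, D1_shift_left])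
  have hae : ∀ᵐ x ∂μ, ∀ᵐ y ∂μ, D1 x y = c := by
    filter_upwards [hc] with x hxc
    filter_upwards [hx x] with y hy
    exact hy.trans hxc
  refine ⟨c, ?_, (Measure.ae_prod_iff_ae_ae (hm (measurableSet_singleton c))).2 hae⟩
  obtain ⟨x, hx⟩ := hae.exists
  obtain ⟨y, hy⟩ := hx.exists
  exact hy ▸ ⟨D1_nonneg x y, D1_le_one x y⟩

end ConstantDistance

/-! ### Generic points. -/

section Generic

variable {A : Type*} [TopologicalSpace A]

/-- The two-sided Birkhoff averages along the shift. -/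
noncomputable def avg (f : (ℤ → A) → ℂ) (x : ℤ → A) (n : ℕ) : ℂ :=
  (1 / (2 * n + 1) : ℂ) * ∑ k ∈ Finset.Icc (-(n : ℤ)) n, f ((shift A ^ k) x)

omit [TopologicalSpace A] in
theorem norm_avg_sub_le (f g : (ℤ → A) → ℂ) (x y : ℤ → A) (n : ℕ) {b : ℤ → ℝ}
    (h : ∀ k, ‖f ((shift A ^ k) x) - g ((shift A ^ k) y)‖ ≤ b k) :
    ‖avg f x n - avg g y n‖ ≤ (∑ k ∈ Finset.Icc (-(n : ℤ)) n, b k) / (2 * n + 1) := by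
  unfold avg
  rw [← mul_sub, ← Finset.sum_sub_distrib, norm_mul, mul_comm]
  have : ‖(1 / (2 * n + 1) : ℂ)‖ = 1 / (2 * n + 1) := by
    rw [norm_div, norm_one]
    congr 1
    exact_mod_cast Complex.norm_natCast (2 * n + 1)
  rw [this, mul_one_div]
  exact div_le_div_of_nonneg_right
    ((norm_sum_le _ _).trans (Finset.sum_le_sum fun k _ => h k)) (by positivity)

theorem card_window (n : ℕ) : ((Finset.Icc (-(n : ℤ)) n).card : ℝ) = 2 * n + 1 := by
  have : (Finset.Icc (-(n : ℤ)) n).card = 2 * n + 1 := by rw [Int.card_Icc]; omega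
  rw [this]; push_cast; ring

omit [TopologicalSpace A] in
theorem norm_avg_sub_le_const (f g : (ℤ → A) → ℂ) (x : ℤ → A) (n : ℕ) {ε : ℝ}
    (h : ∀ z, ‖f z - g z‖ ≤ ε) : ‖avg f x n - avg g x n‖ ≤ ε := by
  refine (norm_avg_sub_le f g x x n fun k => h _).trans ?_
  rw [Finset.sum_const, nsmul_eq_mul, card_window, mul_div_cancel_left₀ _ (by positivity)]

variable [Finite A] [DiscreteTopology A]

/-- Continuous functions almost depend on finitely many coordinates only. -/
theorem exists_window (f : C(ℤ → A, ℂ)) {ε : ℝ} (hε : 0 < ε) :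
    ∃ m : ℕ, ∀ x y : ℤ → A, (∀ i ∈ Finset.Icc (-(m : ℤ)) m, x i = y i) → ‖f x - f y‖ < ε := by
  let V : ℕ → Set ((ℤ → A) × (ℤ → A)) := fun m =>
    {p | ∀ i ∈ Finset.Icc (-(m : ℤ)) m, p.1 i = p.2 i}
  have hV : ∀ m, IsClosed (V m) := fun m => by
    simp only [V, Set.ofPred_forall]
    exact isClosed_biInter fun i _ => isClosed_eq (by fun_prop) (by fun_prop)
  have hanti : Antitone V := fun m n hmn p hp i hi =>
    hp i (by simp only [Finset.mem_Icc] at hi ⊢; omega)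
  obtain ⟨m, hm⟩ := exists_subset_nhds_of_compactSpace hanti.directed_ge hV
    -- The closed sets `V m` decrease to the diagonal, so by compactness one of them lies in this
    -- neighbourhood of it.
    (U := {p | ‖f p.1 - f p.2‖ < ε}) (by
      rintro ⟨x, y⟩ hp
      have hxy : x = y := funext fun i =>
        Set.mem_iInter.1 hp i.natAbs i (by rw [Finset.mem_Icc]; omega)
      subst hxy
      refine (isOpen_lt (by fun_prop) continuous_const).mem_nhds ?_
      simpa using hε)
  exact ⟨m, fun x y h => hm (a := (x, y)) h⟩

omit [DiscreteTopology A] in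
-- A time k contributes more than ε only if x and y differ at some k + w with |w| ≤ m, and then at
-- most 2‖f‖. Summing over k first turns this into mismatch counts of shifted points.
theorem norm_avg_sub_avg_le (f : C(ℤ → A, ℂ)) {ε : ℝ} (m : ℕ)
    (hm : ∀ x y : ℤ → A, (∀ i ∈ Finset.Icc (-(m : ℤ)) m, x i = y i) → ‖f x - f y‖ < ε)
    (hε : 0 < ε) (x y : ℤ → A) (n : ℕ) :
    ‖avg f x n - avg f y n‖ ≤ ε + 2 * ‖f‖ * (∑ w ∈ Finset.Icc (-(m : ℤ)) m,
      (mismatches ((shift A ^ w) x) ((shift A ^ w) y) n : ℝ)) / (2 * n + 1) := by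
  classical
  refine (norm_avg_sub_le f f x y n (b := fun k => ε + 2 * ‖f‖ *
    ∑ w ∈ Finset.Icc (-(m : ℤ)) m, if x (k + w) ≠ y (k + w) then 1 else 0) fun k => ?_).trans
      (le_of_eq ?_)
  · by_cases h : ∀ i ∈ Finset.Icc (-(m : ℤ)) m, (shift A ^ k) x i = (shift A ^ k) y i
    · exact (hm _ _ h).le.trans (le_add_of_nonneg_right (by positivity))
    · push Not at h
      obtain ⟨i, hi, hne⟩ := h
      rw [shift_zpow_apply, shift_zpow_apply, add_comm] at hne
      have h1 : (1 : ℝ) ≤ ∑ w ∈ Finset.Icc (-(m : ℤ)) m, if x (k + w) ≠ y (k + w) then 1 else 0 := by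
        refine le_trans ?_ (Finset.single_le_sum (fun w _ => by positivity) hi)
        rw [if_pos hne]
      have h2 := norm_sub_le (f ((shift A ^ k) x)) (f ((shift A ^ k) y))
      have h3 := f.norm_coe_le_norm ((shift A ^ k) x)
      have h4 := f.norm_coe_le_norm ((shift A ^ k) y)
      have h5 := mul_le_mul_of_nonneg_left h1 (show 0 ≤ 2 * ‖f‖ by positivity)
      linarith
  · rw [Finset.sum_add_distrib, Finset.sum_const, nsmul_eq_mul, card_window, add_div,
      mul_div_cancel_left₀ _ (by positivity), ← Finset.mul_sum, Finset.sum_comm]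
    congr 4
    ext w
    simp only [mismatches, Finset.card_filter, shift_zpow_apply]
    push_cast
    rfl

theorem eventually_norm_avg_sub_avg_le (f : C(ℤ → A, ℂ)) {ε : ℝ} (hε : 0 < ε) :
    ∃ δ > 0, ∀ x y : ℤ → A, d1 x y < δ → ∀ᶠ n in atTop, ‖avg f x n - avg f y n‖ ≤ ε := by
  obtain ⟨m, hm⟩ := exists_window f (half_pos hε)
  have hC : 0 < 2 * ‖f‖ * (2 * m + 1) + 1 := by positivity
  -- Each of the 2m + 1 shifts has mismatch density at most δ eventually; the + 1 keeps the
  -- denominator positive when f = 0.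
  refine ⟨ε / 2 / (2 * ‖f‖ * (2 * m + 1) + 1), by positivity, fun x y hxy => ?_⟩
  set δ := ε / 2 / (2 * ‖f‖ * (2 * m + 1) + 1) with hδ
  have hδ0 : 0 < δ := by positivity
  have hall : ∀ᶠ n : ℕ in atTop, ∀ w ∈ Finset.Icc (-(m : ℤ)) m,
      (mismatches ((shift A ^ w) x) ((shift A ^ w) y) n : ℝ) ≤ δ * (2 * n + 1) :=
    (Finset.eventually_all _).2 fun w _ => eventually_mismatches_le (by rwa [d1_zpow])
  filter_upwards [hall] with n hn
  refine (norm_avg_sub_avg_le f m hm (half_pos hε) x y n).trans ?_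
  have h1 := Finset.sum_le_card_nsmul _ _ _ hn
  rw [nsmul_eq_mul, card_window] at h1
  have h2 : 2 * ‖f‖ * (∑ w ∈ Finset.Icc (-(m : ℤ)) m,
      (mismatches ((shift A ^ w) x) ((shift A ^ w) y) n : ℝ)) / (2 * n + 1) ≤ ε / 2 := by
    rw [div_le_iff₀ (by positivity)]
    have h3 : δ * (2 * ‖f‖ * (2 * m + 1) + 1) = ε / 2 := div_mul_cancel₀ _ hC.ne'
    calc 2 * ‖f‖ * _ ≤ 2 * ‖f‖ * ((2 * m + 1) * (δ * (2 * n + 1))) := by gcongr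
      _ = δ * (2 * ‖f‖ * (2 * m + 1)) * (2 * n + 1) := by ring
      _ ≤ δ * (2 * ‖f‖ * (2 * m + 1) + 1) * (2 * n + 1) := by gcongr; linarith
      _ = ε / 2 * (2 * n + 1) := by rw [h3]
  linarith

variable [MeasurableSpace A] [DiscreteMeasurableSpace A] {μ : Measure (ℤ → A)}

theorem IsGeneric.comp {x : ℤ → A} (hx : IsGeneric μ x) {S : Equiv.Perm (ℤ → A)}
    (hSc : Continuous S) (hS : MeasurePreserving S μ μ) (hcomm : Commute S (shift A)) :
    IsGeneric μ (S x) := by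
  intro f
  have h := hx (f.comp ⟨S, hSc⟩)
  have hI : ∫ y, (f.comp ⟨S, hSc⟩) y ∂μ = ∫ y, f y ∂μ :=
    integral_comp_of_measurePreserving hS f.continuous.aestronglyMeasurable
  rw [hI] at h
  refine h.congr fun n => ?_
  congr 1
  refine Finset.sum_congr rfl fun k _ => ?_
  have := (hcomm.zpow_right k).eq
  exact congrArg f (DFunLike.congr_fun this x)

theorem isGeneric_zpow (hμ : MeasurePreserving (shift A) μ μ) {x : ℤ → A} (hx : IsGeneric μ x)
    (n : ℤ) : IsGeneric μ ((shift A ^ n) x) := by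
  refine hx.comp ?_ (measurePreserving_shift_zpow hμ n) ((Commute.refl _).zpow_left n)
  refine continuous_pi fun i => ?_
  simp only [shift_zpow_apply]
  exact continuous_apply (i + n)

omit [DiscreteMeasurableSpace A] in
theorem IsGeneric.of_d1 {y : ℤ → A} (h : ∀ δ > 0, ∃ x, IsGeneric μ x ∧ d1 x y < δ) :
    IsGeneric μ y := by
  intro f
  change Tendsto (avg f y) atTop _
  rw [Metric.tendsto_atTop']
  intro ε hε
  obtain ⟨δ, hδ, hf⟩ := eventually_norm_avg_sub_avg_le f (half_pos hε)
  obtain ⟨x, hx, hxy⟩ := h δ hδ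
  have hlim : ∀ᶠ n in atTop, dist (avg f x n) (∫ y, f y ∂μ) < ε / 2 :=
    (hx f).eventually (Metric.ball_mem_nhds _ (half_pos hε))
  obtain ⟨N, hN⟩ := eventually_atTop.1 (hlim.and (hf x y hxy))
  refine ⟨N, fun n hn => ?_⟩
  obtain ⟨h1, h2⟩ := hN n hn.le
  have := dist_triangle_left (avg f y n) (∫ y, f y ∂μ) (avg f x n)
  rw [dist_eq_norm (avg f x n) (avg f y n)] at this
  linarith

theorem IsGeneric.of_D1_eq_zero (hμ : MeasurePreserving (shift A) μ μ) {x y : ℤ → A}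
    (hx : IsGeneric μ x) (hxy : D1 x y = 0) : IsGeneric μ y := by
  refine IsGeneric.of_d1 fun δ hδ => ?_
  obtain ⟨_, ⟨n, rfl⟩, hn⟩ := Metric.mem_closure_iff.1 (D1_eq_zero_iff.1 hxy) δ hδ
  refine ⟨(shift A ^ n) x, isGeneric_zpow hμ hx n, ?_⟩
  rw [d1_comm, ← dist_proj, ← shiftB_zpow_proj]
  exact hn

theorem ae_isGeneric [IsProbabilityMeasure μ] (hμ : Ergodic (shift A) μ) :
    ∀ᵐ x ∂μ, IsGeneric μ x := by
  -- A countable dense family of functions leaves a single null set; uniform approximation handles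
  -- the others.
  let F := TopologicalSpace.denseSeq C(ℤ → A, ℂ)
  have hint : ∀ f : C(ℤ → A, ℂ), Integrable f μ := fun f =>
    Integrable.of_bound f.continuous.aestronglyMeasurable ‖f‖
      (ae_of_all _ fun x => f.norm_coe_le_norm x)
  have h : ∀ᵐ x ∂μ, ∀ i, Tendsto (avg (F i) x) atTop (𝓝 (∫ y, F i y ∂μ)) :=
    ae_all_iff.2 fun i => ae_tendsto_twoSided (measurableShift A) hμ (F i).continuous.measurable
      (hint (F i))
  filter_upwards [h] with x hx f
  change Tendsto (avg f x) atTop _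
  rw [Metric.tendsto_atTop']
  intro ε hε
  obtain ⟨i, hi⟩ := (TopologicalSpace.denseRange_denseSeq C(ℤ → A, ℂ)).exists_dist_lt f
    (show 0 < ε / 3 by positivity)
  have hfi : ∀ z, ‖f z - F i z‖ ≤ ε / 3 := fun z => by
    rw [← dist_eq_norm]
    exact (ContinuousMap.dist_apply_le_dist z).trans hi.le
  have hI : ‖∫ y, f y ∂μ - ∫ y, F i y ∂μ‖ ≤ ε / 3 := by
    rw [← integral_sub (hint _) (hint _)]
    simpa using norm_integral_le_of_norm_le_const (μ := μ) (ae_of_all _ hfi)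
  obtain ⟨N, hN⟩ := eventually_atTop.1 ((hx i).eventually
    (Metric.ball_mem_nhds _ (show 0 < ε / 3 by positivity)))
  refine ⟨N, fun n hn => ?_⟩
  have h1 := hN n hn.le
  have h2 := norm_avg_sub_le_const f (F i) x n hfi
  rw [← dist_eq_norm] at h2 hI
  rw [dist_comm] at hI
  have := dist_triangle4 (avg f x n) (avg (F i) x n) (∫ y, F i y ∂μ) (∫ y, f y ∂μ)
  linarith

end Generic

/-! ### Compact isometric systems: minimality and unique ergodicity. -/

section IsometricSystem

variable {Y : Type*} [MetricSpace Y] [CompactSpace Y] {T : Y → Y}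

omit [CompactSpace Y] in
theorem dist_iterate (hT : Isometry T) (n : ℕ) (x y : Y) :
    dist (T^[n] x) (T^[n] y) = dist x y := by
  induction n with
  | zero => rfl
  | succ n ih => rw [Function.iterate_succ_apply', Function.iterate_succ_apply', hT.dist_eq, ih]

/-- A convergent subsequence of the orbit has two close terms whose times differ by at least m; the
isometry cancels the earlier time. -/
theorem exists_iterate_dist_lt (hT : Isometry T) (x : Y) (m : ℕ) {ε : ℝ} (hε : 0 < ε) :
    ∃ p, m ≤ p ∧ dist (T^[p] x) x < ε := by
  obtain ⟨a, -, φ, hφ, ha⟩ := isCompact_univ.tendsto_subseq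
    (x := fun n : ℕ => T^[n] x) (fun _ => Set.mem_univ _)
  obtain ⟨N, hN⟩ := Metric.cauchySeq_iff.1 ha.cauchySeq ε hε
  have hlt : φ N + m ≤ φ (N + m) := by
    have := hφ.add_le_nat m N
    rw [add_comm m N] at this
    omega
  refine ⟨φ (N + m) - φ N, by omega, ?_⟩
  have h := hN (N + m) (by omega) N le_rfl
  simp only [Function.comp_apply] at h
  rw [← dist_iterate hT (φ N), ← Function.iterate_add_apply, Nat.add_sub_cancel' (by omega)]
  exact h

/-- In a compact isometric system, density of the two-sided orbits yields that of forward orbits. -/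
theorem denseRange_iterate (hT : Isometry T)
    (h : ∀ x y : Y, ∀ ε > 0, ∃ m : ℕ, dist (T^[m] x) y < ε ∨ ∃ z, T^[m] z = x ∧ dist z y < ε)
    (x : Y) : DenseRange fun k : ℕ => T^[k] x := by
  rw [Metric.denseRange_iff]
  intro y ε hε
  obtain ⟨m, hm | ⟨z, rfl, hz⟩⟩ := h x y (ε / 2) (half_pos hε)
  · exact ⟨m, by rw [dist_comm]; linarith⟩
  -- Going back m steps to z is replaced by going forward p - m steps, to a near return of z.
  · obtain ⟨p, hp, hpz⟩ := exists_iterate_dist_lt hT z m (half_pos hε)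
    refine ⟨p - m, ?_⟩
    rw [← Function.iterate_add_apply, Nat.sub_add_cancel hp, dist_comm]
    linarith [dist_triangle (T^[p] z) z y]

omit [CompactSpace Y] in
theorem isMinimalSystem_of_denseRange [Nonempty Y] (hd : ∀ x, DenseRange fun k : ℕ => T^[k] x) :
    IsMinimalSystem T := by
  refine ⟨inferInstance, fun C hC hTC => C.eq_empty_or_nonempty.imp_right ?_⟩
  rintro ⟨x, hx⟩
  refine Set.eq_univ_of_univ_subset ((hd x).closure_range ▸ closure_minimal ?_ hC)
  rintro _ ⟨k, rfl⟩
  exact hTC.iterate k hx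

omit [CompactSpace Y] in
theorem eq_of_comp_eq {Z : Type*} [TopologicalSpace Z] [T2Space Z]
    (hd : ∀ x, DenseRange fun k : ℕ => T^[k] x) {φ : Y → Z} (hφ : Continuous φ)
    (h : ∀ x, φ (T x) = φ x) (x y : Y) : φ x = φ y := by
  have hk : ∀ k : ℕ, φ (T^[k] y) = φ y := by
    intro k
    induction k with
    | zero => rfl
    | succ k ih => rw [Function.iterate_succ_apply', h, ih]
  exact congrFun ((hd y).equalizer hφ continuous_const (funext hk)) x

/-- The tent kernel of radius `r`. -/
noncomputable def tent (r : ℝ) (x y : Y) : ℝ := max 0 (r - dist x y)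

omit [CompactSpace Y] in
theorem tent_nonneg (r : ℝ) (x y : Y) : 0 ≤ tent r x y := le_max_left _ _

omit [CompactSpace Y] in
theorem tent_comm (r : ℝ) (x y : Y) : tent r x y = tent r y x := by
  simp only [tent, dist_comm]

omit [CompactSpace Y] in
theorem abs_tent_le {r : ℝ} (hr : 0 < r) (x y : Y) : |tent r x y| ≤ r := by
  rw [abs_of_nonneg (tent_nonneg r x y)]
  exact max_le hr.le (by linarith [dist_nonneg (x := x) (y := y)])

omit [CompactSpace Y] in
theorem continuous_tent (r : ℝ) : Continuous fun p : Y × Y => tent r p.1 p.2 := by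
  unfold tent
  fun_prop

omit [CompactSpace Y] in
theorem tent_map (hT : Isometry T) (r : ℝ) (x y : Y) : tent r (T x) (T y) = tent r x y := by
  simp only [tent, hT.dist_eq]

variable [MeasurableSpace Y] [BorelSpace Y] {μ ν : Measure Y}
  {E : Type*} [NormedAddCommGroup E] [NormedSpace ℝ E]

omit [CompactSpace Y] in
-- The smoothing operator: it regularizes any integrable function and, by `integral_tent_map`,
-- commutes with T.
theorem continuous_integral_tent {e : Y → E} (he : Integrable e ν) {r : ℝ} (hr : 0 < r) :
    Continuous fun x => ∫ y, tent r x y • e y ∂ν := by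
  refine continuous_of_dominated (bound := fun y => r * ‖e y‖) (fun x => ?_) (fun x => ?_)
    (he.norm.const_mul r) (ae_of_all _ fun y => ?_)
  · exact ((continuous_tent r).comp (Continuous.prodMk_right x)).aestronglyMeasurable.smul
      he.aestronglyMeasurable
  · refine ae_of_all _ fun y => ?_
    rw [norm_smul]
    exact mul_le_mul_of_nonneg_right (abs_tent_le hr x y) (norm_nonneg _)
  · exact ((continuous_tent r).comp (Continuous.prodMk_left y)).smul continuous_const

omit [CompactSpace Y] in
theorem integral_tent_map (hT : Isometry T) (hν : MeasurePreserving T ν ν) {e : Y → E}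
    (he : Integrable e ν) (r : ℝ) (x : Y) :
    ∫ y, tent r (T x) y • e y ∂ν = ∫ y, tent r x y • e (T y) ∂ν := by
  rw [← integral_comp_of_measurePreserving hν (g := fun y => tent r (T x) y • e y)]
  · simp only [tent_map hT]
  · exact ((continuous_tent r).comp (Continuous.prodMk_right (T x))).aestronglyMeasurable.smul
      he.aestronglyMeasurable

theorem integrable_tent [IsFiniteMeasure ν] (r : ℝ) (x : Y) :
    Integrable (fun y => tent r x y) ν :=
  ((continuous_tent r).comp (Continuous.prodMk_right x)).integrable_of_hasCompactSupport
    (HasCompactSupport.of_compactSpace _)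

omit [CompactSpace Y] in
/-- The mean of the tent kernel does not depend on its centre. -/
theorem integral_tent_eq (hT : Isometry T) (hd : ∀ x, DenseRange fun k : ℕ => T^[k] x)
    [IsFiniteMeasure ν] (hν : MeasurePreserving T ν ν) {r : ℝ} (hr : 0 < r) (x x' : Y) :
    ∫ y, tent r x y ∂ν = ∫ y, tent r x' y ∂ν := by
  have hc := continuous_integral_tent (ν := ν) (integrable_const (1 : ℝ)) hr
  have hi := integral_tent_map hT hν (integrable_const (1 : ℝ)) r
  simp only [smul_eq_mul, mul_one] at hc hi
  exact eq_of_comp_eq hd hc hi x x'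

/-- The mean is the same for all centres; if it vanished, every ball of radius r would be null, and
so would the space. -/
theorem integral_tent_pos [IsProbabilityMeasure μ] (hT : Isometry T)
    (hd : ∀ x, DenseRange fun k : ℕ => T^[k] x) (hμ : MeasurePreserving T μ μ)
    {r : ℝ} (hr : 0 < r) (x : Y) : 0 < ∫ y, tent r x y ∂μ := by
  refine (integral_nonneg fun y => tent_nonneg r x y).lt_of_ne' fun h0 => ?_
  have hball : ∀ z, μ (Metric.ball z r) = 0 := by
    intro z
    rw [integral_tent_eq hT hd hμ hr x z,
      integral_eq_zero_iff_of_nonneg (fun y => tent_nonneg r z y) (integrable_tent r z)] at h0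
    refine measure_mono_null (fun y hy => ?_) h0
    rw [Metric.mem_ball, dist_comm] at hy
    exact (lt_max_of_lt_right (sub_pos.2 hy)).ne'
  have := measure_null_of_locally_null (μ := μ) Set.univ fun z _ =>
    ⟨Metric.ball z r, mem_nhdsWithin_of_mem_nhds (Metric.ball_mem_nhds z hr), hball z⟩
  simp at this

theorem integrable_mul_tent [IsFiniteMeasure ν] {f : Y → ℝ} (hf : Continuous f) (r : ℝ) (y : Y) :
    Integrable (fun x => f x * tent r x y) ν :=
  (hf.mul ((continuous_tent r).comp (Continuous.prodMk_left y))).integrable_of_hasCompactSupport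
    (HasCompactSupport.of_compactSpace _)

/-- Tent kernels of small radius are an approximate identity. -/
theorem exists_tent_approx [IsProbabilityMeasure μ] (hT : Isometry T)
    (hd : ∀ x, DenseRange fun k : ℕ => T^[k] x) (hμ : MeasurePreserving T μ μ)
    {f : Y → ℝ} (hf : Continuous f) {ε : ℝ} (hε : 0 < ε) :
    ∃ r > 0, ∃ c > 0, (∀ x, ∫ y, tent r x y ∂μ = c) ∧
      ∀ y, |c * f y - ∫ x, f x * tent r x y ∂μ| ≤ ε * c := by
  obtain ⟨x₀⟩ : Nonempty Y := μ.nonempty_of_neZero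
  obtain ⟨r, hr, hfr⟩ := Metric.uniformContinuous_iff.1
    (CompactSpace.uniformContinuous_of_continuous hf) ε hε
  have hc : ∀ x, ∫ y, tent r x y ∂μ = ∫ y, tent r x₀ y ∂μ :=
    fun x => integral_tent_eq hT hd hμ hr x x₀
  refine ⟨r, hr, _, integral_tent_pos hT hd hμ hr x₀, hc, fun y => ?_⟩
  rw [← hc y, ← integral_mul_const, ← integral_sub ((integrable_tent (ν := μ) r y).mul_const _)
    (integrable_mul_tent hf r y), ← integral_const_mul, ← Real.norm_eq_abs]
  refine norm_integral_le_of_norm_le ((integrable_tent (ν := μ) r y).const_mul ε)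
    (ae_of_all μ fun x => ?_)
  rw [tent_comm, mul_comm, ← sub_mul, norm_mul, Real.norm_of_nonneg (tent_nonneg r x y)]
  by_cases h : dist x y < r
  · refine mul_le_mul_of_nonneg_right ?_ (tent_nonneg r x y)
    rw [← dist_eq_norm, dist_comm]
    exact (hfr h).le
  · have : tent r x y = 0 := max_eq_left (by linarith)
    rw [this, mul_zero, mul_zero]

theorem integrable_mul_tent_smul [IsFiniteMeasure μ] [IsFiniteMeasure ν] {f : Y → ℝ}
    (hf : Continuous f) {e : Y → E} (he : Integrable e ν) (r : ℝ) :
    Integrable (fun p : Y × Y => (f p.1 * tent r p.1 p.2) • e p.2) (μ.prod ν) := by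
  have hk : Continuous fun p : Y × Y => f p.1 * tent r p.1 p.2 :=
    (hf.comp continuous_fst).mul (continuous_tent r)
  obtain ⟨C, hC⟩ := (isCompact_range hk).isBounded.exists_norm_le
  refine (he.comp_snd μ).bdd_smul C hk.aestronglyMeasurable (ae_of_all _ fun p => ?_)
  exact hC _ ⟨p, rfl⟩

theorem integral_tent_swap [CompleteSpace E] [IsFiniteMeasure μ] [IsFiniteMeasure ν] {f : Y → ℝ}
    (hf : Continuous f) {e : Y → E} (he : Integrable e ν) (r : ℝ) :
    ∫ y, (∫ x, f x * tent r x y ∂μ) • e y ∂ν = ∫ x, f x • ∫ y, tent r x y • e y ∂ν ∂μ := by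
  have h := integral_integral_swap (μ := μ) (ν := ν)
    (f := fun x y => (f x * tent r x y) • e y) (integrable_mul_tent_smul hf he r)
  simp only [mul_smul, integral_smul] at h
  rw [h]
  simp only [← mul_smul, integral_smul_const]

/-- Integrate f x · tent r x y over both μ and a competitor ν. One order gives nearly c ∫ f dν by
approximation, the other exactly c ∫ f dμ because the ν-mean of the kernel is constant too. -/
theorem isUniquelyErgodic_of_isometry [IsProbabilityMeasure μ] (hT : Isometry T)
    (hd : ∀ x, DenseRange fun k : ℕ => T^[k] x) (hμ : MeasurePreserving T μ μ) :
    IsUniquelyErgodic T μ := by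
  refine ⟨inferInstance, hμ, fun ν _ hν => ext_of_forall_integral_eq_of_IsFiniteMeasure fun f => ?_⟩
  refine eq_of_forall_dist_le fun ε hε => ?_
  obtain ⟨r, hr, c, hc, hcx, hf⟩ := exists_tent_approx hT hd hμ f.continuous hε
  obtain ⟨x₀⟩ : Nonempty Y := μ.nonempty_of_neZero
  have hν' : ∀ x, ∫ y, tent r x y ∂ν = ∫ y, tent r x₀ y ∂ν :=
    fun x => integral_tent_eq hT hd hν hr x x₀
  have hswap : ∀ g : Y → ℝ, Continuous g →
      ∫ y, (∫ x, g x * tent r x y ∂μ) ∂ν = (∫ x, g x ∂μ) * ∫ y, tent r x₀ y ∂ν := by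
    intro g hg
    have h := integral_tent_swap (μ := μ) (ν := ν) hg (integrable_const (1 : ℝ)) r
    simp only [smul_eq_mul, mul_one, hν', integral_mul_const] at h
    exact h
  -- Taking g = 1 in the swap identifies the kernel means of μ and ν.
  have hcc : ∫ y, tent r x₀ y ∂ν = c := by
    have h := hswap (fun _ => 1) continuous_const
    have hcx' : ∀ y, ∫ x, tent r x y ∂μ = c := fun y => by
      simp only [tent_comm r _ y, hcx]
    simp only [one_mul, hcx'] at h
    simpa using h.symm
  have hfi : Integrable f ν := f.integrable ν
  have hKi : Integrable (fun y => ∫ x, f x * tent r x y ∂μ) ν := by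
    have := (integrable_mul_tent_smul (μ := μ) f.continuous
      (integrable_const (μ := ν) (1 : ℝ)) r).integral_prod_right
    simpa using this
  have hle : |∫ y, (c * f y - ∫ x, f x * tent r x y ∂μ) ∂ν| ≤ ε * c := by
    have := norm_integral_le_of_norm_le_const (μ := ν) (f := fun y => c * f y - ∫ x, f x * tent r x y ∂μ)
      (ae_of_all _ hf)
    simpa using this
  rw [integral_sub (hfi.const_mul c) hKi, integral_const_mul, hswap f f.continuous, hcc,
    mul_comm c, ← sub_mul, abs_mul, abs_of_pos hc] at hle
  exact (Real.dist_eq _ _).trans_le (le_of_mul_le_mul_right hle hc)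

omit [CompactSpace Y] in
-- Indicators of closed sets are bounded pointwise limits of continuous functions, and integrals
-- over closed sets determine e.
theorem ae_eq_zero_of_integral_continuous_smul [IsFiniteMeasure μ] [CompleteSpace E] {e : Y → E}
    (he : Integrable e μ) (h : ∀ f : Y → ℝ, Continuous f → ∫ y, f y • e y ∂μ = 0) :
    e =ᵐ[μ] 0 := by
  refine ae_eq_zero_of_forall_setIntegral_isClosed_eq_zero he fun F hF => ?_
  have hlim : Tendsto (fun n : ℕ => ∫ y, (hF.apprSeq n y : ℝ) • e y ∂μ) atTop
      (𝓝 (∫ y, F.indicator e y ∂μ)) := by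
    refine tendsto_integral_of_dominated_convergence (fun y => ‖e y‖) (fun n => ?_) he.norm
      (fun n => ae_of_all _ fun y => ?_) (ae_of_all _ fun y => ?_)
    · exact (NNReal.continuous_coe.comp (hF.apprSeq n).continuous).aestronglyMeasurable.smul
        he.aestronglyMeasurable
    · rw [norm_smul]
      refine mul_le_of_le_one_left (norm_nonneg _) ?_
      rw [Real.norm_of_nonneg (NNReal.coe_nonneg _)]
      exact_mod_cast HasOuterApproxClosed.apprSeq_apply_le_one hF n y
    · have h1 := (tendsto_pi_nhds.1 (HasOuterApproxClosed.tendsto_apprSeq hF) y)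
      have h2 := ((NNReal.continuous_coe.tendsto _).comp h1).smul_const (e y)
      have h3 : F.indicator e y = ((F.indicator (fun _ => (1 : NNReal)) y : NNReal) : ℝ) • e y := by
        by_cases hy : y ∈ F
        · simp [hy]
        · simp [hy]
      rw [h3]
      exact h2
  rw [← integral_indicator hF.measurableSet]
  refine tendsto_nhds_unique hlim ?_
  exact tendsto_const_nhds.congr fun n =>
    (h _ (NNReal.continuous_coe.comp (hF.apprSeq n).continuous)).symm

/-- By Fubini, e is orthogonal to every smoothed continuous function, and these approximate all
continuous functions uniformly. -/
theorem ae_eq_zero_of_integral_tent [IsProbabilityMeasure μ] [CompleteSpace E] (hT : Isometry T)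
    (hd : ∀ x, DenseRange fun k : ℕ => T^[k] x) (hμ : MeasurePreserving T μ μ) {e : Y → E}
    (he : Integrable e μ) (h : ∀ r > 0, ∀ x, ∫ y, tent r x y • e y ∂μ = 0) : e =ᵐ[μ] 0 := by
  refine ae_eq_zero_of_integral_continuous_smul he fun f hf => ?_
  have key : ∀ ε > 0, ‖∫ y, f y • e y ∂μ‖ ≤ ε * ∫ y, ‖e y‖ ∂μ := by
    intro ε hε
    obtain ⟨r, hr, c, hc, -, hfc⟩ := exists_tent_approx hT hd hμ hf hε
    have hswap := integral_tent_swap (μ := μ) hf he r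
    simp only [h r hr, smul_zero, integral_zero] at hswap
    obtain ⟨C, hC⟩ := (isCompact_range hf).isBounded.exists_norm_le
    have hfe : Integrable (fun y => f y • e y) μ :=
      he.bdd_smul C hf.aestronglyMeasurable (ae_of_all _ fun y => hC _ ⟨y, rfl⟩)
    have hKe : Integrable (fun y => (∫ x, f x * tent r x y ∂μ) • e y) μ := by
      have := (integrable_mul_tent_smul (μ := μ) hf he r).integral_prod_right
      simpa only [integral_smul_const] using this
    have hle : ‖∫ y, (c * f y - ∫ x, f x * tent r x y ∂μ) • e y ∂μ‖ ≤ ∫ y, ε * c * ‖e y‖ ∂μ := by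
      refine norm_integral_le_of_norm_le (he.norm.const_mul _) (ae_of_all _ fun y => ?_)
      rw [norm_smul]
      exact mul_le_mul_of_nonneg_right (hfc y) (norm_nonneg _)
    simp only [sub_smul, mul_smul] at hle
    have hcfe : Integrable (fun y => c • f y • e y) μ := hfe.smul c
    rw [integral_sub hcfe hKe, hswap, sub_zero, integral_smul, integral_const_mul,
      norm_smul, Real.norm_of_nonneg hc.le, mul_comm ε, mul_assoc] at hle
    exact le_of_mul_le_mul_left hle hc
  have hlim : Tendsto (fun ε : ℝ => ε * ∫ y, ‖e y‖ ∂μ) (𝓝[>] 0) (𝓝 0) := by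
    have : Tendsto (fun ε : ℝ => ε * ∫ y, ‖e y‖ ∂μ) (𝓝 0) (𝓝 (0 * ∫ y, ‖e y‖ ∂μ)) :=
      tendsto_id.mul_const _
    rw [zero_mul] at this
    exact this.mono_left nhdsWithin_le_nhds
  exact norm_le_zero_iff.1 (ge_of_tendsto hlim (eventually_mem_nhdsWithin.mono key))

end IsometricSystem

/-! ### Ergodicity and continuity of eigenfunctions. -/

section Eigenfunction

/-- Conditioning on a non-null invariant set gives an invariant probability measure, hence μ itself,
so the complement is null. -/
theorem IsUniquelyErgodic.ergodic {Y : Type*} [MeasurableSpace Y] {T : Y → Y} {μ : Measure Y}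
    (h : IsUniquelyErgodic T μ) : Ergodic T μ := by
  obtain ⟨hp, hm, hu⟩ := h
  refine ⟨hm, ⟨fun s hs hTs => ?_⟩⟩
  rw [Filter.eventuallyConst_set']
  by_cases h0 : μ s = 0
  · exact Or.inl (ae_eq_empty.2 h0)
  right
  have hr : MeasurePreserving T (ProbabilityTheory.cond μ s) (ProbabilityTheory.cond μ s) := by
    have := hm.restrict_preimage hs
    rw [hTs] at this
    exact this.smul_measure _
  have hc := hu _ (ProbabilityTheory.cond_isProbabilityMeasure h0) hr
  refine ae_eq_univ.2 ?_
  rw [← hc]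
  exact ProbabilityTheory.cond_apply hs μ sᶜ ▸ by simp

variable {Y : Type*} [MetricSpace Y] [CompactSpace Y] [MeasurableSpace Y] [BorelSpace Y]
  {T : Y → Y} {μ : Measure Y}

omit [MetricSpace Y] [CompactSpace Y] [BorelSpace Y] in
theorem IsEigenfunction.norm_eq_one [IsFiniteMeasure μ] (hμ : MeasurePreserving T μ μ) {ξ : ℂ}
    {e : Y → ℂ} (he : IsEigenfunction T μ ξ e) : ‖ξ‖ = 1 := by
  have hi : Integrable e μ := he.memLp.integrable (by norm_num)
  have h1 : ∫ y, ‖e (T y)‖ ∂μ = ∫ y, ‖e y‖ ∂μ :=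
    integral_comp_of_measurePreserving hμ hi.norm.aestronglyMeasurable
  have h2 : ∫ y, ‖e (T y)‖ ∂μ = ‖ξ‖ * ∫ y, ‖e y‖ ∂μ := by
    rw [← integral_const_mul]
    refine integral_congr_ae (he.eigen.mono fun y hy => ?_)
    simp only [hy, norm_mul]
  have h0 : ∫ y, ‖e y‖ ∂μ ≠ 0 := by
    rw [Ne, integral_eq_zero_iff_of_nonneg (fun y => norm_nonneg _) hi.norm]
    exact fun h => he.ne_zero (h.mono fun y hy => norm_eq_zero.1 hy)
  exact mul_right_cancel₀ h0 (by rw [← h2, h1, one_mul])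

/-- Eigenfunctions of compact minimal isometric systems are continuous, of constant modulus. -/
theorem IsEigenfunction.exists_continuous [IsProbabilityMeasure μ] (hT : Isometry T)
    (hd : ∀ x, DenseRange fun k : ℕ => T^[k] x) (hμ : MeasurePreserving T μ μ) {ξ : ℂ}
    {e : Y → ℂ} (he : IsEigenfunction T μ ξ e) :
    ∃ g : Y → ℂ, Continuous g ∧ g =ᵐ[μ] e ∧ (∀ y, g (T y) = ξ * g y) ∧
      ∃ c : ℝ, 0 < c ∧ ∀ y, ‖g y‖ = c := by
  have hi : Integrable e μ := he.memLp.integrable (by norm_num)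
  have hξ := he.norm_eq_one hμ
  have hex : ∃ r > 0, ∃ x, ∫ y, tent r x y • e y ∂μ ≠ 0 := by
    by_contra! h
    exact he.ne_zero (ae_eq_zero_of_integral_tent hT hd hμ hi h)
  obtain ⟨r, hr, x₀, hx₀⟩ := hex
  let G : Y → ℂ := fun x => ∫ y, tent r x y • e y ∂μ
  have hGc : Continuous G := continuous_integral_tent hi hr
  have hGT : ∀ x, G (T x) = ξ * G x := by
    intro x
    change ∫ y, tent r (T x) y • e y ∂μ = ξ * ∫ y, tent r x y • e y ∂μ
    rw [integral_tent_map hT hμ hi, ← integral_const_mul]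
    refine integral_congr_ae (he.eigen.mono fun y hy => ?_)
    simp only [hy, mul_smul_comm]
  have hGn : ∀ x, ‖G x‖ = ‖G x₀‖ := fun x =>
    eq_of_comp_eq hd hGc.norm (fun y => by rw [hGT, norm_mul, hξ, one_mul]) x x₀
  have hG0 : ∀ x, G x ≠ 0 := fun x => by
    rw [← norm_ne_zero_iff, hGn]
    exact norm_ne_zero_iff.2 hx₀
  have hξ0 : ξ ≠ 0 := by
    rw [← norm_ne_zero_iff, hξ]
    exact one_ne_zero
  have herg := (isUniquelyErgodic_of_isometry hT hd hμ).ergodic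
  -- G is a nowhere vanishing continuous eigenfunction for the same ξ, so the quotient is invariant.
  obtain ⟨κ, hκ⟩ := herg.ae_eq_const_of_ae_eq_comp_ae (g := fun y => e y / G y)
    (by
      simp only [div_eq_mul_inv]
      exact hi.aestronglyMeasurable.mul (hGc.inv₀ hG0).aestronglyMeasurable)
    (he.eigen.mono fun y hy => by
      simp only [Function.comp_apply, hy, hGT, mul_div_mul_left _ _ hξ0])
  have hge : (fun y => κ * G y) =ᵐ[μ] e := by
    filter_upwards [hκ] with y hy
    rw [← show e y / G y = κ from hy, div_mul_cancel₀ _ (hG0 y)]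
  refine ⟨fun y => κ * G y, continuous_const.mul hGc, hge, fun y => ?_, ‖κ‖ * ‖G x₀‖, ?_, ?_⟩
  · simp only [hGT, mul_left_comm]
  · refine mul_pos (norm_pos_iff.2 ?_) (norm_pos_iff.2 hx₀)
    rintro rfl
    exact he.ne_zero (hge.symm.trans (ae_of_all _ fun y => zero_mul _))
  · intro y
    rw [norm_mul, hGn]

end Eigenfunction

/-! ### Measurability and compactness of orbit closures. -/

section OrbitClosure

variable {A : Type*}

theorem measurableSet_ballB (u : Space A) (r : ℝ) : MeasurableSet (Metric.ball u r) :=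
  MeasurableSpace.measurableSet_generateFrom ⟨u, r, rfl⟩

theorem exists_dist_zpow_lt {u v : Space A} (hv : v ∈ closure (orbitB u)) {ε : ℝ} (hε : 0 < ε) :
    ∃ n : ℤ, dist v ((shiftB A ^ n) u) < ε := by
  obtain ⟨_, ⟨n, rfl⟩, hn⟩ := Metric.mem_closure_iff.1 hv ε hε
  exact ⟨n, hn⟩

/-- Closedness alone is not enough for the ball σ-algebra; countability of the orbit writes the
closure with countably many balls. -/
theorem measurableSet_closure_orbitB (u : Space A) : MeasurableSet (closure (orbitB u)) := by
  have h : closure (orbitB u) =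
      ⋂ k : ℕ, ⋃ n : ℤ, Metric.ball ((shiftB A ^ n) u) (1 / ((k : ℝ) + 1)) := by
    ext v
    simp only [Set.mem_iInter, Set.mem_iUnion, Metric.mem_ball]
    refine ⟨fun hv k => exists_dist_zpow_lt hv (by positivity), fun hv => ?_⟩
    refine Metric.mem_closure_iff.2 fun ε hε => ?_
    obtain ⟨k, hk⟩ := exists_nat_one_div_lt hε
    obtain ⟨n, hn⟩ := hv k
    exact ⟨_, ⟨n, rfl⟩, hn.trans hk⟩
  rw [h]
  exact MeasurableSet.iInter fun k => MeasurableSet.iUnion fun n => measurableSet_ballB _ _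

theorem borelSpace_closure_orbitB (u : Space A) :
    BorelSpace (closure (orbitB u) : Set (Space A)) := by
  refine ⟨le_antisymm ?_ ?_⟩
  · change MeasurableSpace.comap Subtype.val (MeasurableSpace.generateFrom _) ≤ _
    rw [MeasurableSpace.comap_generateFrom]
    refine MeasurableSpace.generateFrom_le ?_
    rintro _ ⟨_, ⟨v, r, rfl⟩, rfl⟩
    exact MeasurableSpace.measurableSet_generateFrom
      (Metric.isOpen_ball.preimage continuous_subtype_val)
  · refine MeasurableSpace.generateFrom_le fun s hs => ?_
    let B : ℤ × ℕ → Set (closure (orbitB u) : Set (Space A)) := fun p =>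
      Subtype.val ⁻¹' Metric.ball ((shiftB A ^ p.1) u) (1 / ((p.2 : ℝ) + 1))
    -- The orbit is a countable dense set, so balls around its points form a countable base of the
    -- closure.
    have h : s = ⋃ p ∈ {p | B p ⊆ s}, B p := by
      refine Set.Subset.antisymm (fun y hy => ?_) (Set.iUnion₂_subset fun p hp => hp)
      obtain ⟨ε, hε, hball⟩ := Metric.isOpen_iff.1 (show IsOpen s from hs) y hy
      obtain ⟨k, hk⟩ := exists_nat_one_div_lt (half_pos hε)
      obtain ⟨n, hn⟩ := exists_dist_zpow_lt y.2 (show (0 : ℝ) < 1 / ((k : ℝ) + 1) by positivity)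
      refine Set.mem_iUnion₂.2 ⟨(n, k), fun z hz => hball ?_, hn⟩
      rw [Metric.mem_ball, Subtype.dist_eq]
      have hz : dist (z : Space A) ((shiftB A ^ n) u) < 1 / ((k : ℝ) + 1) := hz
      linarith [dist_triangle_right (z : Space A) y ((shiftB A ^ n) u)]
    rw [h]
    exact MeasurableSet.biUnion (Set.to_countable _) fun p _ =>
      measurable_subtype_coe (measurableSet_ballB _ _)

variable [MeasurableSpace A] [DiscreteMeasurableSpace A] {μ : Measure (ℤ → A)}

theorem measure_d1_ball_zpow (hμ : MeasurePreserving (shift A) μ μ) (x : ℤ → A) (n : ℤ) (r : ℝ) :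
    μ {y | d1 y ((shift A ^ n) x) < r} = μ {y | d1 y x < r} := by
  rw [← (measurePreserving_shift_zpow hμ n).measure_preimage
    (measurableSet_lt (measurable_d1 _) measurable_const).nullMeasurableSet]
  simp only [Set.preimage_ofPred_eq, d1_zpow]

/-- Almost every y is within r of the orbit of x, so countably many balls of equal measure cover
almost everything. -/
theorem measure_d1_ball_pos [NeZero μ] (hμ : MeasurePreserving (shift A) μ μ) {x : ℤ → A}
    (hx : ∀ᵐ y ∂μ, D1 x y = 0) {r : ℝ} (hr : 0 < r) : μ {y | d1 y x < r} ≠ 0 := by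
  intro h0
  have h : ∀ᵐ y ∂μ, ∀ n : ℤ, ¬ d1 y ((shift A ^ n) x) < r := by
    refine ae_all_iff.2 fun n => ?_
    rw [ae_iff]
    simpa only [not_not, measure_d1_ball_zpow hμ] using h0
  obtain ⟨y, hy, hn⟩ := (hx.and h).exists
  obtain ⟨n, hlt⟩ := exists_dist_zpow_lt (D1_eq_zero_iff.1 hy) hr
  rw [shiftB_zpow_proj, dist_proj] at hlt
  exact hn n hlt

/-- All balls of the same radius along an orbit have the same positive measure, so only finitely
many of them are disjoint. -/
theorem totallyBounded_orbitB [IsProbabilityMeasure μ] (hμ : MeasurePreserving (shift A) μ μ)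
    {x : ℤ → A} (hx : ∀ᵐ y ∂μ, D1 x y = 0) : TotallyBounded (orbitB (proj x)) := by
  rw [Metric.totallyBounded_iff]
  by_contra! hcon
  obtain ⟨ε, hε, hcon⟩ := hcon
  -- Without a finite ε-net, an infinite ε-separated sequence in the orbit can be chosen greedily;
  -- balls of radius ε/2 around it are disjoint and of equal positive measure.
  obtain ⟨a, ha⟩ := Set.seq_of_forall_finite_exists
    (P := fun (n : ℤ) (t : Set ℤ) => ∀ k ∈ t, ε ≤ d1 ((shift A ^ n) x) ((shift A ^ k) x)) (by
      intro t ht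
      obtain ⟨_, ⟨n, rfl⟩, hn⟩ := Set.not_subset.1
        (hcon ((fun k : ℤ => (shiftB A ^ k) (proj x)) '' t) (ht.image _))
      refine ⟨n, fun k hk => not_lt.1 fun hlt => hn ?_⟩
      refine Set.mem_iUnion₂.2 ⟨_, Set.mem_image_of_mem _ hk, ?_⟩
      simpa only [Metric.mem_ball, shiftB_zpow_proj, dist_proj] using hlt)
  have hdist : ∀ m n, m < n → ε ≤ d1 ((shift A ^ a n) x) ((shift A ^ a m) x) :=
    fun m n hmn => ha n _ ⟨m, hmn, rfl⟩
  have hdisj : Pairwise (Function.onFun Disjoint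
      fun n => {y | d1 y ((shift A ^ a n) x) < ε / 2}) := by
    refine (pairwise_disjoint_on _).2 fun m n hmn => Set.disjoint_left.2 fun y hm hn => ?_
    have h1 := hdist m n hmn
    have h2 := d1_triangle ((shift A ^ a n) x) y ((shift A ^ a m) x)
    rw [d1_comm _ y] at h2
    simp only [Set.mem_ofPred_eq] at hm hn
    linarith
  have hsum := measure_iUnion (μ := μ) hdisj fun n =>
    measurableSet_lt (measurable_d1 _) measurable_const
  simp only [measure_d1_ball_zpow hμ,
    ENNReal.tsum_const_eq_top_of_ne_zero (measure_d1_ball_pos hμ hx (half_pos hε))] at hsum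
  exact measure_ne_top μ _ hsum

theorem isCompact_closure_orbitB [IsProbabilityMeasure μ] (hμ : MeasurePreserving (shift A) μ μ)
    {x : ℤ → A} (hx : ∀ᵐ y ∂μ, D1 x y = 0) : IsCompact (closure (orbitB (proj x))) :=
  (totallyBounded_orbitB hμ hx).closure.isCompact_of_isClosed isClosed_closure

end OrbitClosure

/-! ### The class of a point and its image as a dynamical system. -/

section Class

variable {A : Type*}

/-- The class of `x` for the relation `D1 x y = 0`. -/
def d1Class (x : ℤ → A) : Set (ℤ → A) := {y | D1 x y = 0}

theorem preimage_closure_orbitB (x : ℤ → A) :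
    proj ⁻¹' closure (orbitB (proj x)) = d1Class x :=
  Set.ext fun _ => D1_eq_zero_iff.symm

theorem image_d1Class (x : ℤ → A) : proj '' d1Class x = closure (orbitB (proj x)) := by
  rw [← preimage_closure_orbitB, Set.image_preimage_eq _ proj_surjective]

theorem shift_mem_d1Class_iff {x y : ℤ → A} : shift A y ∈ d1Class x ↔ y ∈ d1Class x := by
  simp only [d1Class, Set.mem_ofPred_eq, D1_shift_right]

theorem mapsTo_shift_d1Class (x : ℤ → A) : Set.MapsTo (shift A) (d1Class x) (d1Class x) :=
  fun _ => shift_mem_d1Class_iff.2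

theorem mapsTo_shiftB_d1Class (x : ℤ → A) :
    Set.MapsTo (shiftB A) (proj '' d1Class x) (proj '' d1Class x) := by
  rintro _ ⟨y, hy, rfl⟩
  exact ⟨_, mapsTo_shift_d1Class x hy, rfl⟩

theorem image_d1Class_eq_closure {x : ℤ → A} {u : Space A} (hu : u ∈ proj '' d1Class x) :
    proj '' d1Class x = closure (orbitB u) := by
  rw [image_d1Class] at hu ⊢
  exact (closure_orbitB_eq hu).symm

theorem isometry_restrict {K : Set (Space A)} (hK : Set.MapsTo (shiftB A) K K) :
    Isometry (Set.MapsTo.restrict _ _ _ hK) :=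
  Isometry.of_dist_eq fun u v => shiftB_dist (u : Space A) v

theorem surjective_restrict_d1Class {x : ℤ → A}
    (h : Set.MapsTo (shiftB A) (proj '' d1Class x) (proj '' d1Class x)) :
    Function.Surjective (Set.MapsTo.restrict _ _ _ h) := by
  rintro ⟨_, y, hy, rfl⟩
  refine ⟨⟨proj ((shift A).symm y), _, ?_, rfl⟩, Subtype.ext ?_⟩
  · rwa [← shift_mem_d1Class_iff, Equiv.apply_symm_apply]
  · exact congrArg proj ((shift A).apply_symm_apply y)

theorem coe_iterate_restrict {K : Set (Space A)} (hK : Set.MapsTo (shiftB A) K K) (m : ℕ) (u : K) :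
    (((Set.MapsTo.restrict _ _ _ hK)^[m] u : K) : Space A) = (shiftB A ^ (m : ℤ)) u := by
  rw [zpow_natCast, ← Equiv.Perm.iterate_eq_pow]
  exact (Function.Semiconj.iterate_right (f := Subtype.val) (fun _ => rfl) m) u

/-- Density of two-sided orbits in the form needed by `denseRange_iterate`, where negative powers
appear only through preimages. -/
theorem exists_iterate_restrict_dist_lt {x : ℤ → A}
    (h : Set.MapsTo (shiftB A) (proj '' d1Class x) (proj '' d1Class x))
    (u v : (proj '' d1Class x : Set (Space A))) {ε : ℝ} (hε : 0 < ε) :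
    ∃ m : ℕ, dist ((Set.MapsTo.restrict _ _ _ h)^[m] u) v < ε ∨
      ∃ z, (Set.MapsTo.restrict _ _ _ h)^[m] z = u ∧ dist z v < ε := by
  have hK := image_d1Class_eq_closure u.2
  obtain ⟨n, hn⟩ := exists_dist_zpow_lt (hK.le v.2) hε
  rw [dist_comm] at hn
  obtain ⟨m, rfl | rfl⟩ := n.eq_nat_or_neg
  · refine ⟨m, Or.inl ?_⟩
    rwa [Subtype.dist_eq, coe_iterate_restrict]
  · refine ⟨m, Or.inr ⟨⟨(shiftB A ^ (-(m : ℤ))) u, ?_⟩, Subtype.ext ?_, hn⟩⟩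
    · exact hK.ge (subset_closure ⟨_, rfl⟩)
    · rw [coe_iterate_restrict]
      simp

variable [MeasurableSpace A] {μ : Measure (ℤ → A)}

theorem pushMeasure_apply [DiscreteMeasurableSpace A] {x : ℤ → A}
    {s : Set (proj '' d1Class x : Set (Space A))} (hs : MeasurableSet s) :
    pushMeasure μ (d1Class x) s = μ (proj ⁻¹' (Subtype.val '' s)) := by
  have hK : MeasurableSet (proj '' d1Class x) :=
    image_d1Class x ▸ measurableSet_closure_orbitB (proj x)
  rw [pushMeasure, (MeasurableEmbedding.subtype_coe hK).comap_apply,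
    Measure.map_apply measurable_proj ((MeasurableEmbedding.subtype_coe hK).measurableSet_image' hs)]

theorem isProbabilityMeasure_pushMeasure [DiscreteMeasurableSpace A] {x : ℤ → A}
    (hx : μ (d1Class x) = 1) : IsProbabilityMeasure (pushMeasure μ (d1Class x)) := by
  refine ⟨?_⟩
  rw [pushMeasure_apply MeasurableSet.univ, Set.image_univ, Subtype.range_coe, image_d1Class,
    preimage_closure_orbitB, hx]

theorem measurePreserving_restrict_d1Class [DiscreteMeasurableSpace A] {x : ℤ → A}
    (hμ : MeasurePreserving (shift A) μ μ)
    (h : Set.MapsTo (shiftB A) (proj '' d1Class x) (proj '' d1Class x))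
    (hm : Measurable (Set.MapsTo.restrict _ _ _ h)) :
    MeasurePreserving (Set.MapsTo.restrict _ _ _ h) (pushMeasure μ (d1Class x))
      (pushMeasure μ (d1Class x)) := by
  have hK : MeasurableSet (proj '' d1Class x) :=
    image_d1Class x ▸ measurableSet_closure_orbitB (proj x)
  refine ⟨hm, Measure.ext fun s hs => ?_⟩
  rw [Measure.map_apply hm hs, pushMeasure_apply (hm hs), pushMeasure_apply hs]
  rw [← hμ.measure_preimage (measurable_proj
    ((MeasurableEmbedding.subtype_coe hK).measurableSet_image' hs)).nullMeasurableSet]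
  congr 1
  ext y
  constructor
  · rintro ⟨v, hv, hvy⟩
    exact ⟨_, hv, congrArg (shiftB A) hvy⟩
  · rintro ⟨v, hv, hvy⟩
    have hy : proj y ∈ proj '' d1Class x := by
      refine Set.mem_image_of_mem _ (shift_mem_d1Class_iff.1 ?_)
      have := v.2
      rw [hvy, image_d1Class] at this
      rw [← preimage_closure_orbitB]
      exact this
    refine ⟨⟨proj y, hy⟩, ?_, rfl⟩
    rw [Set.mem_preimage]
    convert hv
    exact Subtype.ext hvy.symm

theorem eLpNorm_two_eq_of_norm_eq {Y : Type*} [MeasurableSpace Y] {m : Measure Y}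
    [IsProbabilityMeasure m] {g : Y → ℂ} {c : ℝ} (hc : 0 < c) (hg : ∀ y, ‖g y‖ = c) :
    eLpNorm g 2 m = ENNReal.ofReal c := by
  have h : eLpNorm g 2 m = eLpNorm (fun _ => c) 2 m :=
    eLpNorm_congr_norm_ae (ae_of_all _ fun y => by rw [hg, Real.norm_of_nonneg hc.le])
  rw [h, eLpNorm_const _ (by norm_num) (NeZero.ne m)]
  simp [Real.enorm_of_nonneg hc.le]

end Class
end Besicovitch

/-! ### The main theorem. -/

open Besicovitch
theorem mainTheorem8 {A : Type*} [Finite A] [TopologicalSpace A] [DiscreteTopology A]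
    [MeasurableSpace A] [DiscreteMeasurableSpace A]
    (μ : Measure (ℤ → A)) [IsProbabilityMeasure μ] (hμ : Ergodic (shift A) μ) :
    ∃ c ∈ Set.Icc (0 : ℝ) 1,
      -- a)
      (∀ᵐ p ∂(μ.prod μ), D1 p.1 p.2 = c) ∧
      (c = 0 → ∃ X : Set (ℤ → A),
        -- b)
        (IsD1Class X ∧ MeasurableSet X ∧ μ X = 1 ∧ ∀ x ∈ X, IsGeneric μ x) ∧
        -- c)
        (∀ x ∈ X, IsCompact (closure (orbitB (proj x)))) ∧
        -- d)
        ((∀ u ∈ proj '' X, proj '' X = closure (orbitB u)) ∧ X = proj ⁻¹' (proj '' X)) ∧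
        ∃ (hX : Set.MapsTo (shift A) X X)
          (hX' : Set.MapsTo (shiftB A) (proj '' X) (proj '' X)),
          -- e)
          (MeasurableSet (proj '' X) ∧ BorelSpace (proj '' X : Set (Space A)) ∧
            CompactSpace (proj '' X : Set (Space A)) ∧
            IsMinimalSystem (Set.MapsTo.restrict _ _ _ hX') ∧
            Isometry (Set.MapsTo.restrict _ _ _ hX') ∧ Function.Bijective (Set.MapsTo.restrict _ _ _ hX') ∧
            IsUniquelyErgodic (Set.MapsTo.restrict _ _ _ hX') (pushMeasure μ X)) ∧
          -- f)
          (∀ (ξ : ℂ) (e : (proj '' X : Set (Space A)) → ℂ),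
            IsEigenfunction (Set.MapsTo.restrict _ _ _ hX') (pushMeasure μ X) ξ e →
            ∃ g : (proj '' X : Set (Space A)) → ℂ,
              Continuous g ∧ g =ᵐ[pushMeasure μ X] e ∧
              IsEigenfunction (Set.MapsTo.restrict _ _ _ hX) (μ.comap (Subtype.val : X → (ℤ → A))) ξ
                (g ∘ projOn X) ∧
              (∀ x : X, g (projOn X (Set.MapsTo.restrict _ _ _ hX x)) = ξ * g (projOn X x)) ∧
              (eLpNorm e 2 (pushMeasure μ X) = 1 → ∀ x : X, ‖g (projOn X x)‖ = 1))) := by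
  obtain ⟨c, hc, hD⟩ := ae_D1_eq_const μ hμ
  refine ⟨c, hc, hD, ?_⟩
  rintro rfl
  have hσ := hμ.toMeasurePreserving
  -- One generic point with a full-measure class suffices; its class is X.
  obtain ⟨x₀, hx₀, hgen⟩ := ((Measure.ae_ae_of_ae_prod hD).and (ae_isGeneric hμ)).exists
  have hXm : MeasurableSet (d1Class x₀) := by
    rw [← preimage_closure_orbitB]
    exact measurable_proj (measurableSet_closure_orbitB _)
  have hX1 : μ (d1Class x₀) = 1 := prob_compl_eq_zero_iff hXm |>.1 hx₀
  have hcomp : IsCompact (closure (orbitB (proj x₀))) := isCompact_closure_orbitB hσ hx₀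
  have hKm : MeasurableSet (proj '' d1Class x₀) :=
    image_d1Class x₀ ▸ measurableSet_closure_orbitB _
  have hBorel : BorelSpace (proj '' d1Class x₀ : Set (Space A)) :=
    image_d1Class x₀ ▸ borelSpace_closure_orbitB _
  have hComp : CompactSpace (proj '' d1Class x₀ : Set (Space A)) :=
    isCompact_iff_compactSpace.1 (image_d1Class x₀ ▸ hcomp)
  refine ⟨d1Class x₀, ⟨⟨x₀, rfl⟩, hXm, hX1, fun y hy => hgen.of_D1_eq_zero hσ hy⟩,
    fun y hy => ?_, ⟨fun u hu => image_d1Class_eq_closure hu, ?_⟩,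
    mapsTo_shift_d1Class x₀, mapsTo_shiftB_d1Class x₀, ?_⟩
  · rw [← image_d1Class_eq_closure (Set.mem_image_of_mem proj hy), image_d1Class]
    exact hcomp
  · rw [image_d1Class, preimage_closure_orbitB]
  have hT := isometry_restrict (mapsTo_shiftB_d1Class x₀)
  have hsurj := surjective_restrict_d1Class (mapsTo_shiftB_d1Class x₀)
  have hd := denseRange_iterate hT fun u v ε hε =>
    exists_iterate_restrict_dist_lt (mapsTo_shiftB_d1Class x₀) u v hε
  have hmp := measurePreserving_restrict_d1Class hσ (mapsTo_shiftB_d1Class x₀)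
    hT.continuous.measurable
  have hprob := isProbabilityMeasure_pushMeasure hX1
  have hne : Nonempty (proj '' d1Class x₀ : Set (Space A)) :=
    (pushMeasure μ (d1Class x₀)).nonempty_of_neZero
  refine ⟨⟨hKm, hBorel, hComp, isMinimalSystem_of_denseRange hd, hT, ⟨hT.injective, hsurj⟩,
    isUniquelyErgodic_of_isometry hT hd hmp⟩, fun ξ e he => ?_⟩
  obtain ⟨g, hgc, hge, hgT, r, hr, hgr⟩ := he.exists_continuous hT hd hmp
  have hXprob : IsProbabilityMeasure (μ.comap (Subtype.val : d1Class x₀ → ℤ → A)) := by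
    refine ⟨?_⟩
    rw [(MeasurableEmbedding.subtype_coe hXm).comap_apply, Set.image_univ, Subtype.range_coe, hX1]
  have hproj : Measurable (projOn (d1Class x₀)) :=
    (measurable_proj.comp measurable_subtype_coe).subtype_mk
  refine ⟨g, hgc, hge, ⟨?_, fun h0 => ?_, ae_of_all _ fun x => hgT (projOn _ x)⟩,
    fun x => hgT (projOn _ x), fun h1 x => ?_⟩
  · exact MemLp.of_bound (hgc.measurable.comp hproj).aestronglyMeasurable r
      (ae_of_all _ fun x => (hgr _).le)
  · obtain ⟨x, hx⟩ := h0.exists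
    have hx : g (projOn _ x) = 0 := hx
    exact hr.ne' (by rw [← hgr (projOn _ x), hx, norm_zero])
  -- For a probability measure the constant modulus r is the L² norm, so normalization forces r = 1.
  · rw [← eLpNorm_congr_ae hge, eLpNorm_two_eq_of_norm_eq hr hgr, ENNReal.ofReal_eq_one] at h1
    rw [hgr, h1]
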